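/- Let $M$ be a connected (smooth, Hausdorff) manifold of dimension $n\ge 1$, and let $F\colon TM\to\mathbb R$ be a Randers metric on $M$: $F=\alpha+\beta$, where $\alpha$ is the norm of a smooth Riemannian metric $(\alpha_{ij})$ (also denoted $\alpha$), $\beta$ is a smooth $1$-form, and $F$ is a Finsler metric, i.e. $F$ is continuous on $TM$, smooth off the zero section, positively homogeneous of degree one, and the vertical Hessian of $F^2/2$ is positive definite at every nonzero tangent vector. Suppose that $F$ is non-Riemannian, i.e. $F$ is not the norm of a smooth Riemannian metric. A (smooth) linear connection $\nabla$ on $M$ is called *compatible* (with $F$) if its parallel transports preserve $F$, i.e. $F$ is constant along every parallel vector field along a smooth curve. For a linear connection with torsion $T$, put $\|T_p\|^2=\sum_{i<j}\sum_k (T_{ij}^k)^2$, the components being taken in an $\alpha$-orthonormal basis of $T_pM$ (the value is independent of the basis). A compatible linear connection is called *extremal* if at each point $p$ its torsion has the smallest norm $\|T_p\|$ among the torsions at $p$ of all compatible linear connections. 1. A compatible linear connection exists on $M$ if and only if the vector field $\beta^\sharp$ dual to $\beta$ with respect to $\alpha$ has positive constant $\alpha$-length. 2. In that case the extremal compatible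 linear connection $\nabla$ exists and is unique. Let $p\in M$ and let $u^1,\dots,u^n$ be local coordinates around $p$ such that $(\partial/\partial u^1)_p,\dots,(\partial/\partial u^n)_p$ is an $\alpha$-orthonormal basis of $T_pM$, $\beta_1(p)=\dots=\beta_{n-1}(p)=0$ and $\beta_n(p)\ne 0$, where $\beta_i=\beta(\partial/\partial u^i)$. Let $\Gamma_{ij}^k$ and $\Gamma_{ij}^{*k}$ be the connection parameters of $\nabla$ and of the Levi-Civita connection $\nabla^*$ of $\alpha$ (so $\nabla_{\partial_i}\partial_j=\Gamma_{ij}^k\partial_k$), and $T_{ij}^k=\Gamma_{ij}^k-\Gamma_{ji}^k$ the torsion components of $\nabla$. Then, all functions being evaluated at $p$ and $\partial_i=\partial/\partial u^i$, $$\Gamma_{ij}^r=\Gamma_{ij}^{*r}-\tfrac12\left(T_{jr}^i+T_{ir}^j-T_{ij}^r\right)\qquad(i,j,r=1,\dots,n),$$ and - $T_{ab}^c=0$ for $a<b<n$ and $c<n$; - $T_{ab}^n=\dfrac1{\beta_n}\left(\partial_a\beta_b-\partial_b\beta_a\right)$ for $a<b<n$; - $T_{an}^a=\Gamma_{aa}^{*n}-\dfrac1{\beta_n}\,\partial_a\beta_a$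 for $a<n$; - $T_{an}^n=\Gamma_{an}^{*n}-\dfrac1{\beta_n}\,\partial_n\beta_a$ for $a<n$; - $T_{an}^c=\Gamma_{ac}^{*n}-\dfrac1{2\beta_n}\left(\partial_a\beta_c+\partial_c\beta_a\right)$ for $a,c<n$, $a\ne c$. -/

import Mathlib

open Bundle Set
open scoped Manifold ContDiff Topology

noncomputable section

namespace RandersGB

variable {n : ℕ} {M : Type*} [TopologicalSpace M] [ChartedSpace (EuclideanSpace ℝ (Fin n)) M]

/-- Linear (affine) connections on `M`: covariant derivatives on the tangent bundle. Following
Mathlib's argument order, `nabla Y x v` is `(∇_v Y)(x)`. Smoothness is a separate condition. -/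
abbrev LinConn (n : ℕ) (M : Type*) [TopologicalSpace M]
    [ChartedSpace (EuclideanSpace ℝ (Fin n)) M] [IsManifold (𝓡 n) ∞ M] :=
  CovariantDerivative (𝓡 n) (EuclideanSpace ℝ (Fin n)) (TangentSpace (𝓡 n) : M → Type _)

/-! ### Local coordinates -/

/-- The `i`-th coordinate `y^i(v)` of a tangent vector `v` at `x` in the local coordinates `e`. -/
def coord (e : OpenPartialHomeomorph M (EuclideanSpace ℝ (Fin n))) {x : M}
    (v : TangentSpace (𝓡 n) x) (i : Fin n) : ℝ :=
  (show EuclideanSpace ℝ (Fin n) from mfderiv (𝓡 n) (𝓡 n) e x v) i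

/-- The coordinate vector field `∂/∂u^i` of the local coordinates `e` (meaningful on `e.source`):
the pullback by `e` of the `i`-th standard basis vector. -/
def coordField (e : OpenPartialHomeomorph M (EuclideanSpace ℝ (Fin n))) (i : Fin n) (x : M) :
    TangentSpace (𝓡 n) x :=
  VectorField.mpullback (𝓡 n) (𝓡 n) e
    (fun _ ↦ (EuclideanSpace.single i (1 : ℝ) : EuclideanSpace ℝ (Fin n))) x

/-- The partial derivative `∂f/∂u^i` at `p` of a function `f` in the local coordinates `e`. -/
def partialDeriv (e : OpenPartialHomeomorph M (EuclideanSpace ℝ (Fin n))) (i : Fin n)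
    (f : M → ℝ) (p : M) : ℝ :=
  fderiv ℝ (fun z ↦ f (e.symm z)) (e p) (EuclideanSpace.single i 1)

/-- The component `β_i = β(∂/∂u^i)` of a 1-form. -/
def formComp (e : OpenPartialHomeomorph M (EuclideanSpace ℝ (Fin n)))
    (β : ∀ x : M, TangentSpace (𝓡 n) x →L[ℝ] ℝ) (i : Fin n) (x : M) : ℝ :=
  β x (coordField e i x)

/-- The connection parameter `Γ_{ij}^k`, the `k`-th coordinate of `∇_{∂_i} ∂_j`. -/
def connParam [IsManifold (𝓡 n) ∞ M] (e : OpenPartialHomeomorph M (EuclideanSpace ℝ (Fin n)))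
    (nabla : LinConn n M) (i j k : Fin n) (x : M) : ℝ :=
  coord e (nabla (coordField e j) x (coordField e i x)) k

/-- The torsion component `T_{ij}^k`, the `k`-th coordinate of `T(∂_i, ∂_j)`. -/
def torsionComp [IsManifold (𝓡 n) ∞ M] (e : OpenPartialHomeomorph M (EuclideanSpace ℝ (Fin n)))
    (nabla : LinConn n M) (i j k : Fin n) (x : M) : ℝ :=
  coord e (nabla.torsion x (coordField e i x) (coordField e j x)) k

/-! ### Finsler metrics and compatible linear connections -/

/-- Finsler metrics: continuous on `TM`, smooth off the zero section, positively homogeneous of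
degree one, with positive definite vertical Hessian of the energy `F²/2` at nonzero vectors. The
Hessian at `v` is evaluated on the pair `(w, w)` as a second derivative along the line `v + s w`. -/
structure IsFinslerMetric [IsManifold (𝓡 n) ∞ M] (F : TangentBundle (𝓡 n) M → ℝ) : Prop where
  continuous : Continuous F
  smooth : ContMDiffOn (𝓡 n).tangent 𝓘(ℝ, ℝ) ∞ F {v | v.2 ≠ 0}
  homogeneous : ∀ (x : M) (v : TangentSpace (𝓡 n) x) (t : ℝ), 0 < t →
    F ⟨x, t • v⟩ = t * F ⟨x, v⟩
  convex : ∀ (x : M) (v w : TangentSpace (𝓡 n) x), v ≠ 0 → w ≠ 0 →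
    0 < iteratedDeriv 2 (fun s : ℝ ↦ F ⟨x, v + s • w⟩ ^ 2 / 2) 0

/-- `F` is Riemannian if it is the norm of a smooth Riemannian metric. -/
def IsRiemannianNorm [IsManifold (𝓡 n) ∞ M] (F : TangentBundle (𝓡 n) M → ℝ) : Prop :=
  ∃ g : ContMDiffRiemannianMetric (𝓡 n) ∞ (EuclideanSpace ℝ (Fin n))
      (fun x : M ↦ TangentSpace (𝓡 n) x),
    ∀ (x : M) (v : TangentSpace (𝓡 n) x), F ⟨x, v⟩ = √(g.inner x v v)

/-- The vector field `X` along `c : [0,1] → M` is parallel: its coordinates solve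
`(X^k)' = - ∑ (c^i)' X^j Γ_{ij}^k ∘ c`. The equation at a given parameter value is invariant under
changes of coordinates, so it is asked for in some coordinate system around the point. -/
def IsParallelAlong [IsManifold (𝓡 n) ∞ M] (nabla : LinConn n M) (c : ℝ → M)
    (X : ∀ t : ℝ, TangentSpace (𝓡 n) (c t)) : Prop :=
  ∀ t ∈ Icc (0 : ℝ) 1, ∃ e ∈ IsManifold.maximalAtlas (𝓡 n) ∞ M, c t ∈ e.source ∧
    ∀ k : Fin n, HasDerivWithinAt (fun s ↦ coord e (X s) k)
      (-∑ i : Fin n, ∑ j : Fin n, derivWithin (fun s ↦ (e (c s)) i) (Icc 0 1) t *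
        coord e (X t) j * connParam e nabla i j k (c t)) (Icc 0 1) t

/-- A compatible linear connection: a smooth linear connection whose parallel transports along
smooth curves preserve the Finslerian length of tangent vectors. -/
structure IsCompatible [IsManifold (𝓡 n) ∞ M] (nabla : LinConn n M)
    (F : TangentBundle (𝓡 n) M → ℝ) : Prop where
  smooth : nabla.ContMDiffCovariantDerivative ∞
  parallel : ∀ (c : ℝ → M) (X : ∀ t : ℝ, TangentSpace (𝓡 n) (c t)),
    ContMDiffOn 𝓘(ℝ, ℝ) (𝓡 n) ∞ c (Icc 0 1) → IsParallelAlong nabla c X →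
    ∀ t ∈ Icc (0 : ℝ) 1, F ⟨c t, X t⟩ = F ⟨c 0, X 0⟩

/-! ### The Riemannian part and Randers metrics

The Riemannian metric `α` is the Riemannian structure of the tangent bundle. -/

theorem finiteDimensional_tangent (x : M) : FiniteDimensional ℝ (TangentSpace (𝓡 n) x) :=
  inferInstanceAs (FiniteDimensional ℝ (EuclideanSpace ℝ (Fin n)))

section Riemannian

variable [IsManifold (𝓡 n) ∞ M] [RiemannianBundle (fun x : M ↦ TangentSpace (𝓡 n) x)]

/-- `F = α + β` is a Randers metric with Riemannian part the ambient Riemannian metric. -/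
structure IsRandersMetric (F : TangentBundle (𝓡 n) M → ℝ)
    (β : ∀ x : M, TangentSpace (𝓡 n) x →L[ℝ] ℝ) : Prop where
  finsler : IsFinslerMetric F
  smooth_form : ContMDiff (𝓡 n) ((𝓡 n).prod 𝓘(ℝ, EuclideanSpace ℝ (Fin n) →L[ℝ] ℝ)) ∞
    (fun x ↦ TotalSpace.mk' (EuclideanSpace ℝ (Fin n) →L[ℝ] ℝ)
      (E := fun x : M ↦ TangentSpace (𝓡 n) x →L[ℝ] ℝ) x (β x))
  eq_add : ∀ (x : M) (v : TangentSpace (𝓡 n) x), F ⟨x, v⟩ = ‖v‖ + β x v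

theorem completeSpace_tangent (x : M) : CompleteSpace (TangentSpace (𝓡 n) x) :=
  haveI := finiteDimensional_tangent (n := n) x
  FiniteDimensional.complete ℝ (TangentSpace (𝓡 n) x)

/-- The vector field dual to the 1-form `β`: `⟪sharp β x, v⟫ = β x v`. -/
def sharp (β : ∀ x : M, TangentSpace (𝓡 n) x →L[ℝ] ℝ) (x : M) : TangentSpace (𝓡 n) x :=
  haveI := completeSpace_tangent (n := n) x
  (InnerProductSpace.toDual ℝ (TangentSpace (𝓡 n) x)).symm (β x)

/-- The norm of the torsion at `p`: the square root of the sum of the squares of the components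
`T_{ij}^k`, `i < j`, in an orthonormal basis of the tangent space (the value does not depend on
the basis). -/
def torsionNorm (nabla : LinConn n M) (p : M) : ℝ :=
  haveI := finiteDimensional_tangent (n := n) p
  let b := stdOrthonormalBasis ℝ (TangentSpace (𝓡 n) p)
  √(∑ i, ∑ j ∈ Finset.Ioi i, ∑ k, inner ℝ (nabla.torsion p (b i) (b j)) (b k) ^ 2)

/-- An extremal compatible linear connection: the pointwise norm of its torsion is minimal among
all compatible linear connections. -/
structure IsExtremal (nabla : LinConn n M) (F : TangentBundle (𝓡 n) M → ℝ) : Prop where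
  compatible : IsCompatible nabla F
  minimal : ∀ nabla' : LinConn n M, IsCompatible nabla' F →
    ∀ p : M, torsionNorm nabla p ≤ torsionNorm nabla' p

set_option synthInstance.maxHeartbeats 400000 in
/-- The Levi-Civita connection: metric and torsion-free. -/
structure IsLeviCivita
    [IsContMDiffRiemannianBundle (𝓡 n) ∞ (EuclideanSpace ℝ (Fin n))
      (fun x : M ↦ TangentSpace (𝓡 n) x)] (D : LinConn n M) : Prop where
  metric : D.IsMetricCompatible
  torsion_free : D.torsion = 0

end Riemannian

/-- Coordinates `e` around `p` adapted to the Randers metric: the coordinate vectors at `p` are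
orthonormal for the Riemannian part, and all components of `β` at `p` but the last one vanish. -/
structure IsAdapted {m : ℕ} {M : Type*} [TopologicalSpace M]
    [ChartedSpace (EuclideanSpace ℝ (Fin (m + 1))) M] [IsManifold (𝓡 (m + 1)) ∞ M]
    [RiemannianBundle (fun x : M ↦ TangentSpace (𝓡 (m + 1)) x)]
    (e : OpenPartialHomeomorph M (EuclideanSpace ℝ (Fin (m + 1))))
    (β : ∀ x : M, TangentSpace (𝓡 (m + 1)) x →L[ℝ] ℝ) (p : M) : Prop where
  mem_atlas : e ∈ IsManifold.maximalAtlas (𝓡 (m + 1)) ∞ M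
  mem_source : p ∈ e.source
  orthonormal : Orthonormal ℝ (fun i : Fin (m + 1) ↦ coordField e i p)
  formComp_eq_zero : ∀ a : Fin m, formComp e β a.castSucc p = 0
  formComp_last_ne_zero : formComp e β (Fin.last m) p ≠ 0

end RandersGB

end

open RandersGB

noncomputable section

namespace RandersGB

/-! Write V for `sharp β`. If X is parallel along a curve, so is −X; hence a compatible connection
keeps both F(X) = |X| + ⟨V, X⟩ and F(−X) = |X| − ⟨V, X⟩ constant, and therefore |X| and ⟨V, X⟩
separately. Through every tangent vector, and in every direction, there is a short parallel field,
so differentiating at its starting point shows that the connection is metric and that ∇V = 0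
(`IsCompatible.isMetricCompatible`, `IsCompatible.sharp_parallel`). The converse is the product rule
(`isCompatible_of_metric`). Consequently |V| is constant on a connected manifold, and it is nonzero
since otherwise F would be the Riemannian norm.

At a point, two compatible connections differ by a tensor A with ⟨A y x, z⟩ skew in y, z and A V =
0, and their torsions differ by the alternation of A. Minimising the torsion is thus an orthogonal
projection onto the space of such alternations. Sufficient conditions for a torsion T to be
orthogonal to it are `IsExtremalTensor`: T has no component entirely in V^⊥, and ⟨T(V, y), z⟩ is
symmetric on V^⊥. Pythagoras then gives minimality, and uniqueness follows because A is determined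
by its alternation (`IsExtremalTensor.sum_norm_sq_add`, `IsDifferenceTensor.eq_zero`).

Existence is explicit: with S = ∇*V, `extremalForm` is a correction of the Levi-Civita connection
built smoothly from V and S, and |V| constant means exactly that S takes values in V^⊥. The
coordinate formulas are then linear algebra from four facts at p: Γ − Γ* is skew in its last two
indices, Γ* is symmetric in its first two, ∂_i β_j = β_n Γ_ij^n, and T_an^c is symmetric in a and c.
-/

/-! ### Smoothness of sections -/

/-- The vector field `X` is differentiable at `x`. -/
abbrev DiffFieldAt {n : ℕ} {M : Type*} [TopologicalSpace M]
    [ChartedSpace (EuclideanSpace ℝ (Fin n)) M] [IsManifold (𝓡 n) ∞ M]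
    (X : ∀ x : M, TangentSpace (𝓡 n) x) (x : M) : Prop :=
  MDifferentiableAt (𝓡 n) (𝓡 n).tangent (fun y ↦ (⟨y, X y⟩ : TangentBundle (𝓡 n) M)) x

/-- The vector field `X` is smooth at `x`. -/
abbrev SmoothFieldAt {n : ℕ} {M : Type*} [TopologicalSpace M]
    [ChartedSpace (EuclideanSpace ℝ (Fin n)) M] [IsManifold (𝓡 n) ∞ M]
    (X : ∀ x : M, TangentSpace (𝓡 n) x) (x : M) : Prop :=
  ContMDiffAt (𝓡 n) (𝓡 n).tangent ∞ (fun y ↦ (⟨y, X y⟩ : TangentBundle (𝓡 n) M)) x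

/-- The section `A` of `Hom(TM, TM)` is smooth at `x`. -/
abbrev SmoothHomAt {n : ℕ} {M : Type*} [TopologicalSpace M]
    [ChartedSpace (EuclideanSpace ℝ (Fin n)) M] [IsManifold (𝓡 n) ∞ M]
    (A : ∀ x : M, TangentSpace (𝓡 n) x →L[ℝ] TangentSpace (𝓡 n) x) (x : M) : Prop :=
  ContMDiffAt (𝓡 n) ((𝓡 n).prod 𝓘(ℝ, EuclideanSpace ℝ (Fin n) →L[ℝ] EuclideanSpace ℝ (Fin n))) ∞
    (fun x ↦ TotalSpace.mk' (EuclideanSpace ℝ (Fin n) →L[ℝ] EuclideanSpace ℝ (Fin n))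
      (E := fun x : M ↦ TangentSpace (𝓡 n) x →L[ℝ] TangentSpace (𝓡 n) x) x (A x)) x

section Smoothness

variable {n : ℕ} {M : Type*} [TopologicalSpace M] [ChartedSpace (EuclideanSpace ℝ (Fin n)) M]

/-- A map into a space of continuous linear maps with finite-dimensional source is smooth if its
values on a basis are. -/
theorem contMDiffAt_clm_of_basis {G : Type*} [NormedAddCommGroup G] [NormedSpace ℝ G]
    {f : M → EuclideanSpace ℝ (Fin n) →L[ℝ] G} {x₀ : M}
    (h : ∀ i, ContMDiffAt (𝓡 n) 𝓘(ℝ, G) ∞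
      (fun x ↦ f x (EuclideanSpace.basisFun (Fin n) ℝ i)) x₀) :
    ContMDiffAt (𝓡 n) 𝓘(ℝ, EuclideanSpace ℝ (Fin n) →L[ℝ] G) ∞ f x₀ := by
  have key : f = fun x ↦ ∑ i, ContinuousLinearMap.smulRightL ℝ (EuclideanSpace ℝ (Fin n)) G
      (EuclideanSpace.proj i) (f x (EuclideanSpace.basisFun (Fin n) ℝ i)) := by
    funext x
    ext v
    conv_lhs => rw [← (EuclideanSpace.basisFun (Fin n) ℝ).sum_repr v]
    simp
  rw [key]
  refine ContMDiffAt.sum fun i _ ↦ ?_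
  exact (ContinuousLinearMap.contMDiff _).contMDiffAt.comp x₀ (h i)

variable [IsManifold (𝓡 n) ∞ M]

/-- The frame of the tangent bundle near `x₀` given by the preferred trivialization. -/
def frame (x₀ : M) (i : Fin n) : ∀ x : M, TangentSpace (𝓡 n) x :=
  (trivializationAt (EuclideanSpace ℝ (Fin n)) (TangentSpace (𝓡 n) : M → Type _) x₀).localFrame
    (EuclideanSpace.basisFun (Fin n) ℝ).toBasis i

/-- The domain of `frame x₀`. -/
def frameDomain (n : ℕ) {M : Type*} [TopologicalSpace M] [ChartedSpace (EuclideanSpace ℝ (Fin n)) M]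
    [IsManifold (𝓡 n) ∞ M] (x₀ : M) : Set M :=
  (trivializationAt (EuclideanSpace ℝ (Fin n)) (TangentSpace (𝓡 n) : M → Type _) x₀).baseSet

theorem mem_frameDomain (x₀ : M) : x₀ ∈ frameDomain n x₀ :=
  FiberBundle.mem_baseSet_trivializationAt _ _ x₀

theorem isOpen_frameDomain (x₀ : M) : IsOpen (frameDomain n x₀) :=
  (trivializationAt (EuclideanSpace ℝ (Fin n)) (TangentSpace (𝓡 n) : M → Type _) x₀).open_baseSet

theorem frameDomain_mem_nhds (x₀ : M) : frameDomain n x₀ ∈ 𝓝 x₀ :=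
  (isOpen_frameDomain x₀).mem_nhds (mem_frameDomain x₀)

theorem contMDiffAt_frame {x₀ x : M} (hx : x ∈ frameDomain n x₀) (i : Fin n) :
    SmoothFieldAt (frame x₀ i) x :=
  contMDiffAt_localFrame_of_mem ∞ _ _ i hx

theorem mdifferentiableAt_frame {x₀ x : M} (hx : x ∈ frameDomain n x₀) (i : Fin n) :
    DiffFieldAt (frame x₀ i) x :=
  (contMDiffAt_frame hx i).mdifferentiableAt (by simp)

theorem symmL_basisFun {x₀ x : M} (hx : x ∈ frameDomain n x₀) (i : Fin n) :
    (trivializationAt (EuclideanSpace ℝ (Fin n)) (TangentSpace (𝓡 n) : M → Type _) x₀).symmL ℝ x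
      (EuclideanSpace.basisFun (Fin n) ℝ i) = frame x₀ i x := by
  rw [frame, Trivialization.localFrame_apply_of_mem_baseSet _ _ hx]
  simp [Trivialization.basisAt, Trivialization.symmL_apply _ hx]
  rfl

/-- A section of `Hom(TM, TM)` is smooth if its values on the frame are. -/
theorem contMDiffAt_hom_of_frame {A : ∀ x : M, TangentSpace (𝓡 n) x →L[ℝ] TangentSpace (𝓡 n) x}
    {x₀ : M}
    (h : ∀ i, SmoothFieldAt (fun y ↦ A y (frame x₀ i y)) x₀) :
    SmoothHomAt A x₀ := by
  refine (contMDiffAt_hom_bundle _).2 ⟨contMDiffAt_id, contMDiffAt_clm_of_basis fun i ↦ ?_⟩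
  have h1 := (contMDiffAt_section x₀).1 (h i)
  refine h1.congr_of_eventuallyEq ?_
  filter_upwards [frameDomain_mem_nhds (n := n) x₀] with x hx
  simp only [ContinuousLinearMap.inCoordinates, ContinuousLinearMap.comp_apply,
    symmL_basisFun hx]
  rw [Trivialization.continuousLinearMapAt_apply, Trivialization.coe_linearMapAt_of_mem _ hx]

section Riemannian

variable [RiemannianBundle (fun x : M ↦ TangentSpace (𝓡 n) x)]

/-- The Riemannian metric read in the trivialization at `x₀`. -/
def gram (x₀ x : M) :
    EuclideanSpace ℝ (Fin n) →L[ℝ] EuclideanSpace ℝ (Fin n) →L[ℝ] ℝ :=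
  let s := (trivializationAt (EuclideanSpace ℝ (Fin n)) (TangentSpace (𝓡 n) : M → Type _) x₀).symmL
    ℝ x
  (innerSL ℝ (E := TangentSpace (𝓡 n) x)).bilinearComp s s

/-- Positive definiteness gives injectivity, and a finite-dimensional space has the dimension of its
dual. Inverting the Gram map recovers a vector field from its scalar products with a frame. -/
theorem isInvertible_gram {x₀ x : M} (hx : x ∈ frameDomain n x₀) :
    (gram (n := n) x₀ x).IsInvertible := by
  have inj : Function.Injective (gram (n := n) x₀ x) := by
    rw [injective_iff_map_eq_zero]
    intro v hv
    have h0 := congr($hv v)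
    simp only [gram, ContinuousLinearMap.bilinearComp_apply, innerSL_apply_apply,
      zero_apply, inner_self_eq_zero] at h0
    have h1 := Trivialization.continuousLinearMapAt_symmL (R := ℝ)
      (trivializationAt (EuclideanSpace ℝ (Fin n)) (TangentSpace (𝓡 n) : M → Type _) x₀) hx v
    rw [← h1, h0, map_zero]
  have hrank : Module.finrank ℝ (EuclideanSpace ℝ (Fin n)) =
      Module.finrank ℝ (EuclideanSpace ℝ (Fin n) →L[ℝ] ℝ) := by
    rw [← LinearEquiv.finrank_eq (LinearMap.toContinuousLinearMap (𝕜 := ℝ)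
      (E := EuclideanSpace ℝ (Fin n)) (F' := ℝ))]
    exact (Subspace.dual_finrank_eq (K := ℝ) (V := EuclideanSpace ℝ (Fin n))).symm
  refine ⟨(LinearEquiv.ofInjectiveOfFinrankEq
    (gram (n := n) x₀ x).toLinearMap inj hrank).toContinuousLinearEquiv, ?_⟩
  ext v w
  rfl

variable [IsContMDiffRiemannianBundle (𝓡 n) ∞ (EuclideanSpace ℝ (Fin n))
  (fun x : M ↦ TangentSpace (𝓡 n) x)]

instance isContMDiffRiemannianBundle_one :
    IsContMDiffRiemannianBundle (𝓡 n) 1 (EuclideanSpace ℝ (Fin n))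
      (TangentSpace (𝓡 n) : M → Type _) :=
  IsContMDiffRiemannianBundle.of_le (n := ∞) (by simp)

theorem DiffFieldAt.inner {X Y : ∀ x : M, TangentSpace (𝓡 n) x} {x : M}
    (hX : DiffFieldAt X x) (hY : DiffFieldAt Y x) :
    MDifferentiableAt (𝓡 n) 𝓘(ℝ, ℝ) (fun y ↦ inner ℝ (X y) (Y y)) x :=
  MDifferentiableAt.inner_bundle hX hY

theorem SmoothFieldAt.inner {X Y : ∀ x : M, TangentSpace (𝓡 n) x} {x : M}
    (hX : SmoothFieldAt X x) (hY : SmoothFieldAt Y x) :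
    ContMDiffAt (𝓡 n) 𝓘(ℝ, ℝ) ∞ (fun y ↦ inner ℝ (X y) (Y y)) x :=
  ContMDiffAt.inner_bundle hX hY

theorem contMDiffAt_gram (x₀ : M) :
    ContMDiffAt (𝓡 n) 𝓘(ℝ, EuclideanSpace ℝ (Fin n) →L[ℝ] EuclideanSpace ℝ (Fin n) →L[ℝ] ℝ) ∞
      (gram (n := n) x₀) x₀ := by
  refine contMDiffAt_clm_of_basis fun i ↦ contMDiffAt_clm_of_basis fun j ↦ ?_
  have h1 := (contMDiffAt_frame (mem_frameDomain (n := n) x₀) i).inner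
    (contMDiffAt_frame (mem_frameDomain (n := n) x₀) j)
  refine h1.congr_of_eventuallyEq ?_
  filter_upwards [frameDomain_mem_nhds (n := n) x₀] with x hx
  simp only [gram, ContinuousLinearMap.bilinearComp_apply, innerSL_apply_apply, symmL_basisFun hx]

/-- A vector field is smooth if its scalar products with the frame are. -/
theorem contMDiffAt_of_inner_frame {W : ∀ x : M, TangentSpace (𝓡 n) x} {x₀ : M}
    (h : ∀ i, ContMDiffAt (𝓡 n) 𝓘(ℝ, ℝ) ∞ (fun y ↦ inner ℝ (W y) (frame x₀ i y)) x₀) :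
    SmoothFieldAt W x₀ := by
  let t := trivializationAt (EuclideanSpace ℝ (Fin n)) (TangentSpace (𝓡 n) : M → Type _) x₀
  let l : M → EuclideanSpace ℝ (Fin n) →L[ℝ] ℝ := fun x ↦
    (innerSL ℝ (E := TangentSpace (𝓡 n) x) (W x)).comp (t.symmL ℝ x)
  have hl : ContMDiffAt (𝓡 n) 𝓘(ℝ, EuclideanSpace ℝ (Fin n) →L[ℝ] ℝ) ∞ l x₀ := by
    refine contMDiffAt_clm_of_basis fun i ↦ (h i).congr_of_eventuallyEq ?_
    filter_upwards [frameDomain_mem_nhds (n := n) x₀] with x hx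
    simp only [l, ContinuousLinearMap.comp_apply, innerSL_apply_apply, t, symmL_basisFun hx]
  refine (contMDiffAt_section x₀).2 ?_
  -- In the trivialization W is the inverse Gram map applied to the functional `l`, and inversion is
  -- smooth near an invertible operator.
  have hinv : ContMDiffAt (𝓡 n)
      𝓘(ℝ, (EuclideanSpace ℝ (Fin n) →L[ℝ] ℝ) →L[ℝ] EuclideanSpace ℝ (Fin n)) ∞
      (fun x ↦ (gram (n := n) x₀ x).inverse) x₀ :=
    ((isInvertible_gram (mem_frameDomain (n := n) x₀)).contDiffAt_map_inverse).contMDiffAt.comp x₀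
      (contMDiffAt_gram x₀)
  refine (hinv.clm_apply hl).congr_of_eventuallyEq ?_
  filter_upwards [frameDomain_mem_nhds (n := n) x₀] with x hx
  have hW : t.symmL ℝ x (t ⟨x, W x⟩).2 = W x := by
    have := Trivialization.symmL_continuousLinearMapAt (R := ℝ) t hx (W x)
    rwa [Trivialization.continuousLinearMapAt_apply, Trivialization.coe_linearMapAt_of_mem _ hx]
      at this
  symm
  rw [(isInvertible_gram hx).inverse_apply_eq]
  ext v
  simp only [l, gram, ContinuousLinearMap.comp_apply, ContinuousLinearMap.bilinearComp_apply,
    innerSL_apply_apply]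
  exact congrArg (fun w ↦ inner ℝ w (t.symmL ℝ x v)) hW.symm

end Riemannian

/-- A vector field that is smooth near a point agrees near this point with a smooth one. -/
theorem exists_contMDiff_eventuallyEq [T2Space M] {Y : ∀ x : M, TangentSpace (𝓡 n) x} {x₀ : M}
    {u : Set M} (hu : u ∈ 𝓝 x₀)
    (hY : ∀ x ∈ u, SmoothFieldAt Y x) :
    ∃ Z : ∀ x : M, TangentSpace (𝓡 n) x,
      ContMDiff (𝓡 n) (𝓡 n).tangent ∞ (fun y ↦ (⟨y, Z y⟩ : TangentBundle (𝓡 n) M)) ∧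
      ∀ᶠ x in 𝓝 x₀, Y x = Z x := by
  obtain ⟨v, hvu, hv, hxv⟩ := mem_nhds_iff.1 hu
  -- Multiplication by a bump function supported where Y is smooth, and equal to 1 near the point,
  -- gives the global field.
  obtain ⟨f, -, hf⟩ := (SmoothBumpFunction.nhds_basis_tsupport (I := 𝓡 n) x₀).mem_iff.1
    (hv.mem_nhds hxv)
  refine ⟨(f : M → ℝ) • Y, ?_, ?_⟩
  · exact ContMDiffOn.smul_section_of_tsupport f.contMDiff.contMDiffOn hv hf
      fun x hx ↦ (hY x (hvu hx)).contMDiffWithinAt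
  · filter_upwards [f.eventuallyEq_one] with x hx
    simp [hx]

/-- A smooth linear connection maps locally smooth vector fields to locally smooth sections. -/
theorem contMDiffAt_covariantDerivative [T2Space M] {nabla : LinConn n M}
    (hs : nabla.ContMDiffCovariantDerivative ∞) {Y : ∀ x : M, TangentSpace (𝓡 n) x} {x₀ : M}
    {u : Set M} (hu : u ∈ 𝓝 x₀)
    (hY : ∀ x ∈ u, SmoothFieldAt Y x) :
    SmoothHomAt (nabla Y) x₀ := by
  obtain ⟨Z, hZ, hYZ⟩ := exists_contMDiff_eventuallyEq hu hY
  have h1 := hs.contMDiff.contMDiff (σ := Z) hZ.contMDiffOn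
  refine (h1.contMDiffAt Filter.univ_mem).congr_of_eventuallyEq ?_
  filter_upwards [hYZ.eventually_nhds, hu] with x hx hxu
  have := nabla.isCovariantDerivativeOnUniv.congr_of_eventuallyEq
    ((hY x hxu).mdifferentiableAt (by simp)) (hZ.contMDiffAt.mdifferentiableAt (by simp))
    Filter.univ_mem hx
  rw [this]

end Smoothness

/-! ### The Levi-Civita connection -/

/-- The endomorphism representing a bilinear form on an inner product space. -/
def riesz {W : Type*} [NormedAddCommGroup W] [InnerProductSpace ℝ W] [FiniteDimensional ℝ W]
    (B : W →L[ℝ] W →L[ℝ] ℝ) : W →L[ℝ] W :=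
  haveI := FiniteDimensional.complete ℝ W
  LinearMap.toContinuousLinearMap
    { toFun := fun v ↦ (InnerProductSpace.toDual ℝ W).symm (B v)
      map_add' := fun v w ↦ by simp
      map_smul' := fun c v ↦ by simp }

theorem inner_riesz {W : Type*} [NormedAddCommGroup W] [InnerProductSpace ℝ W]
    [FiniteDimensional ℝ W] (B : W →L[ℝ] W →L[ℝ] ℝ) (v w : W) :
    inner ℝ (riesz B v) w = B v w := by
  have := FiniteDimensional.complete ℝ W
  simp [riesz]

section LeviCivita

open VectorField

instance {n : ℕ} {M : Type*} [TopologicalSpace M] [ChartedSpace (EuclideanSpace ℝ (Fin n)) M]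
    (x : M) : FiniteDimensional ℝ (TangentSpace (𝓡 n) x) :=
  finiteDimensional_tangent x

variable {n : ℕ} {M : Type*} [TopologicalSpace M] [ChartedSpace (EuclideanSpace ℝ (Fin n)) M]
  [IsManifold (𝓡 n) ∞ M]

theorem diffFieldAt_extend {x : M} (v : TangentSpace (𝓡 n) x) :
    DiffFieldAt (FiberBundle.extend (EuclideanSpace ℝ (Fin n)) v) x :=
  FiberBundle.mdifferentiableAt_extend (𝓡 n) (EuclideanSpace ℝ (Fin n)) v

theorem contMDiffAt_mvfderiv {X : ∀ x : M, TangentSpace (𝓡 n) x} {x : M} {f : M → ℝ}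
    (hf : ContMDiffAt (𝓡 n) 𝓘(ℝ, ℝ) ∞ f x) (hX : SmoothFieldAt X x) :
    ContMDiffAt (𝓡 n) 𝓘(ℝ, ℝ) ∞ (fun y ↦ mvfderiv (𝓡 n) f y (X y)) x := by
  have h1 := hf.mfderiv_const (m := ∞) (by simp)
  have h2 : ContMDiffAt (𝓡 n) 𝓘(ℝ, ℝ).tangent ∞
      (fun y ↦ (⟨f y, mfderiv (𝓡 n) 𝓘(ℝ, ℝ) f y (X y)⟩ : TangentBundle 𝓘(ℝ, ℝ) ℝ)) x :=
    ContMDiffAt.clm_apply_of_inCoordinates (b₁ := id) h1 hX hf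
  exact (contMDiff_snd_tangentBundle_modelSpace ℝ 𝓘(ℝ, ℝ)).contMDiffAt.comp x h2

variable [RiemannianBundle (fun x : M ↦ TangentSpace (𝓡 n) x)]

/-- Tangent maps agree if their scalar products with vector fields do. -/
theorem hom_eq_of_inner {x : M}
    {A B : TangentSpace (𝓡 n) x →L[ℝ] TangentSpace (𝓡 n) x}
    (h : ∀ X Z : ∀ x : M, TangentSpace (𝓡 n) x, DiffFieldAt X x → DiffFieldAt Z x →
      inner ℝ (A (X x)) (Z x) = inner ℝ (B (X x)) (Z x)) : A = B := by
  ext1 v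
  refine ext_inner_right ℝ fun w ↦ ?_
  have := h _ _ (diffFieldAt_extend v) (diffFieldAt_extend w)
  simpa using this

/-- Half the right-hand side of the Koszul formula. -/
def koszul (X Y Z : ∀ x : M, TangentSpace (𝓡 n) x) (x : M) : ℝ :=
  1 / 2 * (mvfderiv (𝓡 n) (fun y ↦ inner ℝ (Y y) (Z y)) x (X x)
    + mvfderiv (𝓡 n) (fun y ↦ inner ℝ (X y) (Z y)) x (Y x)
    - mvfderiv (𝓡 n) (fun y ↦ inner ℝ (X y) (Y y)) x (Z x)
    + inner ℝ (mlieBracket (𝓡 n) X Y x) (Z x)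
    - inner ℝ (mlieBracket (𝓡 n) X Z x) (Y x)
    - inner ℝ (mlieBracket (𝓡 n) Y Z x) (X x))

variable [IsContMDiffRiemannianBundle (𝓡 n) ∞ (EuclideanSpace ℝ (Fin n))
  (fun x : M ↦ TangentSpace (𝓡 n) x)]

variable {X X' Y Y' Z Z' : ∀ x : M, TangentSpace (𝓡 n) x} {f : M → ℝ} {x : M}

theorem koszul_add_left (hX : DiffFieldAt X x) (hX' : DiffFieldAt X' x)
    (hY : DiffFieldAt Y x) (hZ : DiffFieldAt Z x) :
    koszul (X + X') Y Z x = koszul X Y Z x + koszul X' Y Z x := by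
  simp [koszul, inner_add_left, mvfderiv_fun_add (hX.inner hZ) (hX'.inner hZ),
    mvfderiv_fun_add (hX.inner hY) (hX'.inner hY), inner_add_right,
    mlieBracket_add_left hX hX']
  ring

theorem koszul_smul_left (hf : MDifferentiableAt (𝓡 n) 𝓘(ℝ, ℝ) f x) (hX : DiffFieldAt X x)
    (hY : DiffFieldAt Y x) (hZ : DiffFieldAt Z x) :
    koszul (f • X) Y Z x = f x * koszul X Y Z x := by
  simp [koszul, inner_smul_left, mvfderiv_fun_mul hf (hX.inner hZ),
    mvfderiv_fun_mul hf (hX.inner hY), inner_smul_right, inner_add_left,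
    mlieBracket_smul_left hf hX]
  ring

theorem koszul_add_right (hX : DiffFieldAt X x) (hY : DiffFieldAt Y x)
    (hZ : DiffFieldAt Z x) (hZ' : DiffFieldAt Z' x) :
    koszul X Y (Z + Z') x = koszul X Y Z x + koszul X Y Z' x := by
  simp [koszul, inner_add_right, mvfderiv_fun_add (hY.inner hZ) (hY.inner hZ'),
    mvfderiv_fun_add (hX.inner hZ) (hX.inner hZ'), inner_add_left,
    mlieBracket_add_right hZ hZ']
  ring

theorem koszul_smul_right (hf : MDifferentiableAt (𝓡 n) 𝓘(ℝ, ℝ) f x) (hX : DiffFieldAt X x)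
    (hY : DiffFieldAt Y x) (hZ : DiffFieldAt Z x) :
    koszul X Y (f • Z) x = f x * koszul X Y Z x := by
  simp [koszul, inner_smul_right, mvfderiv_fun_mul hf (hX.inner hZ),
    mvfderiv_fun_mul hf (hY.inner hZ), inner_smul_left, inner_add_left,
    mlieBracket_smul_right hf hZ, real_inner_comm (Z x)]
  ring

theorem koszul_add_mid (hX : DiffFieldAt X x) (hY : DiffFieldAt Y x)
    (hY' : DiffFieldAt Y' x) (hZ : DiffFieldAt Z x) :
    koszul X (Y + Y') Z x = koszul X Y Z x + koszul X Y' Z x := by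
  simp [koszul, inner_add_left, mvfderiv_fun_add (hY.inner hZ) (hY'.inner hZ),
    mvfderiv_fun_add (hX.inner hY) (hX.inner hY'), inner_add_right,
    mlieBracket_add_right hY hY', mlieBracket_add_left hY hY']
  ring

theorem koszul_smul_mid (hf : MDifferentiableAt (𝓡 n) 𝓘(ℝ, ℝ) f x) (hX : DiffFieldAt X x)
    (hY : DiffFieldAt Y x) (hZ : DiffFieldAt Z x) :
    koszul X (f • Y) Z x = f x * koszul X Y Z x
      + mvfderiv (𝓡 n) f x (X x) * inner ℝ (Y x) (Z x) := by
  simp [koszul, inner_smul_right, mvfderiv_fun_mul hf (hY.inner hZ),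
    mvfderiv_fun_mul hf (hX.inner hY), inner_smul_left, inner_add_left,
    mlieBracket_smul_right hf hY, mlieBracket_smul_left hf hY, real_inner_comm (X x) (Y x)]
  ring

theorem tensorialAt_koszul_left (hY : DiffFieldAt Y x) (hZ : DiffFieldAt Z x) :
    TensorialAt (𝓡 n) (EuclideanSpace ℝ (Fin n)) (fun X ↦ koszul X Y Z x) x where
  smul hf hX := koszul_smul_left hf hX hY hZ
  add hX hX' := koszul_add_left hX hX' hY hZ

theorem tensorialAt_koszul_right (hX : DiffFieldAt X x) (hY : DiffFieldAt Y x) :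
    TensorialAt (𝓡 n) (EuclideanSpace ℝ (Fin n)) (fun Z ↦ koszul X Y Z x) x where
  smul hf hZ := koszul_smul_right hf hX hY hZ
  add hZ hZ' := koszul_add_right hX hY hZ hZ'

/-- The bilinear form `(v, w) ↦ ⟪∇_v Y, w⟫` given by the Koszul formula. -/
def koszulForm (hY : DiffFieldAt Y x) :
    TangentSpace (𝓡 n) x →L[ℝ] TangentSpace (𝓡 n) x →L[ℝ] ℝ :=
  TensorialAt.mkHom₂ (fun X Z ↦ koszul X Y Z x) x (fun _ hZ ↦ tensorialAt_koszul_left hY hZ)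
    (fun _ hX ↦ tensorialAt_koszul_right hX hY)

theorem koszulForm_apply (hX : DiffFieldAt X x) (hY : DiffFieldAt Y x) (hZ : DiffFieldAt Z x) :
    koszulForm hY (X x) (Z x) = koszul X Y Z x :=
  TensorialAt.mkHom₂_apply _ _ hX hZ

open scoped Classical in
/-- The covariant derivative of the Levi-Civita connection as a function. -/
def leviCivitaFun (Y : ∀ x : M, TangentSpace (𝓡 n) x) (x : M) :
    TangentSpace (𝓡 n) x →L[ℝ] TangentSpace (𝓡 n) x :=
  -- The value 0 at points of non-differentiability is arbitrary: the axioms of a covariant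
  -- derivative only test differentiable fields.
  if hY : DiffFieldAt Y x then riesz (koszulForm hY) else 0

theorem inner_leviCivitaFun (hX : DiffFieldAt X x) (hY : DiffFieldAt Y x)
    (hZ : DiffFieldAt Z x) :
    inner ℝ (leviCivitaFun Y x (X x)) (Z x) = koszul X Y Z x := by
  rw [leviCivitaFun, dif_pos hY, inner_riesz, koszulForm_apply hX hY hZ]

variable (n M) in
/-- The Levi-Civita connection. -/
def leviCivita : LinConn n M where
  toFun := leviCivitaFun
  isCovariantDerivativeOnUniv :=
    { add := fun {Y Y' x} hY hY' _ ↦ by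
        refine hom_eq_of_inner fun X Z hX hZ ↦ ?_
        rw [inner_leviCivitaFun hX (mdifferentiableAt_add_section hY hY') hZ,
          koszul_add_mid hX hY hY' hZ, add_apply, inner_add_left,
          inner_leviCivitaFun hX hY hZ, inner_leviCivitaFun hX hY' hZ]
      leibniz := fun {Y f x} hY hf _ ↦ by
        refine hom_eq_of_inner fun X Z hX hZ ↦ ?_
        rw [inner_leviCivitaFun hX (hf.smul_section hY) hZ,
          koszul_smul_mid hf hX hY hZ, add_apply, inner_add_left]
        simp [inner_smul_left, inner_leviCivitaFun hX hY hZ] }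

theorem inner_leviCivita (hX : DiffFieldAt X x) (hY : DiffFieldAt Y x) (hZ : DiffFieldAt Z x) :
    inner ℝ (leviCivita n M Y x (X x)) (Z x) = koszul X Y Z x :=
  inner_leviCivitaFun hX hY hZ

/-- With K the Koszul expression, K(X, Y, Z) + K(X, Z, Y) = X⟨Y, Z⟩ and K(X, Y, Z) − K(Y, X, Z) =
⟨[X, Y], Z⟩. -/
theorem isLeviCivita_leviCivita : IsLeviCivita (leviCivita n M) where
  metric := by
    rw [CovariantDerivative.isMetricCompatible_iff]
    intro x X Y Z hX hY hZ
    beta_reduce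
    rw [inner_leviCivita hX hY hZ, real_inner_comm, inner_leviCivita hX hZ hY]
    simp only [koszul, real_inner_comm (Y _) (Z _), mlieBracket_swap_apply (V := Z) (W := Y)]
    simp only [inner_neg_left]
    ring
  torsion_free := by
    rw [CovariantDerivative.torsion_eq_zero_iff]
    intro X Y x hX hY
    refine ext_inner_right ℝ fun w ↦ ?_
    have hZ := diffFieldAt_extend w
    have hw : w = FiberBundle.extend (EuclideanSpace ℝ (Fin n)) w x := by simp
    rw [hw, inner_sub_left, inner_leviCivita hX hY hZ, inner_leviCivita hY hX hZ]
    simp only [koszul, real_inner_comm (X _) (Y _), mlieBracket_swap_apply (V := Y) (W := X)]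
    simp only [inner_neg_left]
    ring

theorem contMDiffAt_koszul (hX : SmoothFieldAt X x) (hY : SmoothFieldAt Y x)
    (hZ : SmoothFieldAt Z x) : ContMDiffAt (𝓡 n) 𝓘(ℝ, ℝ) ∞ (koszul X Y Z) x := by
  have hle : minSmoothness ℝ (((⊤ : ℕ∞) : ℕ∞ω) + 1) ≤ ((⊤ : ℕ∞) : ℕ∞ω) := by simp
  have : IsManifold (𝓡 n) (minSmoothness ℝ 2) M := by
    rw [minSmoothness_of_isRCLikeNormedField]
    infer_instance
  have : IsManifold (𝓡 n) (((⊤ : ℕ∞) : ℕ∞ω) + 1) M := inferInstanceAs (IsManifold (𝓡 n) ∞ M)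
  have hXY : SmoothFieldAt (mlieBracket (𝓡 n) X Y) x :=
    ContMDiffAt.mlieBracket_vectorField (n := ⊤) (m := ⊤) hX hY hle
  have hXZ : SmoothFieldAt (mlieBracket (𝓡 n) X Z) x :=
    ContMDiffAt.mlieBracket_vectorField (n := ⊤) (m := ⊤) hX hZ hle
  have hYZ : SmoothFieldAt (mlieBracket (𝓡 n) Y Z) x :=
    ContMDiffAt.mlieBracket_vectorField (n := ⊤) (m := ⊤) hY hZ hle
  exact contMDiffAt_const.mul ((((((contMDiffAt_mvfderiv (hY.inner hZ) hX).add
    (contMDiffAt_mvfderiv (hX.inner hZ) hY)).sub (contMDiffAt_mvfderiv (hX.inner hY) hZ)).add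
    (hXY.inner hZ)).sub (hXZ.inner hY)).sub (hYZ.inner hX))

theorem smooth_leviCivita : (leviCivita n M).ContMDiffCovariantDerivative ∞ where
  contMDiff :=
    { contMDiff := fun {Y} hY x _ ↦ by
        have hY' : ∀ y, SmoothFieldAt Y y := fun y ↦
          (hY.contMDiffAt Filter.univ_mem).of_le (by simp)
        refine ContMDiffAt.contMDiffWithinAt (contMDiffAt_hom_of_frame fun i ↦
          contMDiffAt_of_inner_frame fun j ↦ ?_)
        refine (contMDiffAt_koszul (contMDiffAt_frame (mem_frameDomain x) i) (hY' x)
          (contMDiffAt_frame (mem_frameDomain x) j)).congr_of_eventuallyEq ?_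
        filter_upwards [frameDomain_mem_nhds (n := n) x] with y hy
        exact inner_leviCivita (mdifferentiableAt_frame hy i)
          ((hY' y).mdifferentiableAt (by simp)) (mdifferentiableAt_frame hy j) }

end LeviCivita

/-! ### Coordinate vector fields -/

section Coordinates

open VectorField

variable {n : ℕ} {M : Type*} [TopologicalSpace M] [ChartedSpace (EuclideanSpace ℝ (Fin n)) M]
  {e : OpenPartialHomeomorph M (EuclideanSpace ℝ (Fin n))} {x : M}

theorem mdifferentiable_of_mem_maximalAtlas' (he : e ∈ IsManifold.maximalAtlas (𝓡 n) ∞ M) :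
    e.MDifferentiable (𝓡 n) (𝓡 n) :=
  ⟨(contMDiffOn_of_mem_maximalAtlas he).mdifferentiableOn (by simp),
    (contMDiffOn_symm_of_mem_maximalAtlas he).mdifferentiableOn (by simp)⟩

theorem contMDiffAt_coordinates (he : e ∈ IsManifold.maximalAtlas (𝓡 n) ∞ M) (hx : x ∈ e.source) :
    ContMDiffAt (𝓡 n) (𝓡 n) ∞ e x :=
  contMDiffAt_of_mem_maximalAtlas he hx

theorem isInvertible_mfderiv_coordinates (he : e ∈ IsManifold.maximalAtlas (𝓡 n) ∞ M)
    (hx : x ∈ e.source) : (mfderiv (𝓡 n) (𝓡 n) e x).IsInvertible :=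
  ⟨(mdifferentiable_of_mem_maximalAtlas' he).mfderiv hx, rfl⟩

theorem mfderiv_coordField (he : e ∈ IsManifold.maximalAtlas (𝓡 n) ∞ M) (hx : x ∈ e.source)
    (i : Fin n) : mfderiv (𝓡 n) (𝓡 n) e x (coordField e i x) =
      (EuclideanSpace.single i (1 : ℝ) : EuclideanSpace ℝ (Fin n)) :=
  (isInvertible_mfderiv_coordinates he hx).self_apply_inverse _

theorem coord_coordField (he : e ∈ IsManifold.maximalAtlas (𝓡 n) ∞ M) (hx : x ∈ e.source)
    (i j : Fin n) : coord e (coordField e i x) j = if i = j then 1 else 0 := by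
  rw [coord, mfderiv_coordField he hx]
  simp [eq_comm]

theorem coord_add (v w : TangentSpace (𝓡 n) x) (i : Fin n) :
    coord e (v + w) i = coord e v i + coord e w i := by
  simp only [coord, map_add]
  rfl

theorem coord_smul (c : ℝ) (v : TangentSpace (𝓡 n) x) (i : Fin n) :
    coord e (c • v) i = c * coord e v i := by
  simp only [coord, map_smul]
  rfl

/-- The coordinate `y^i` as a linear form. -/
def coordL (e : OpenPartialHomeomorph M (EuclideanSpace ℝ (Fin n))) (x : M) (i : Fin n) :
    TangentSpace (𝓡 n) x →ₗ[ℝ] ℝ where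
  toFun v := coord e v i
  map_add' v w := coord_add v w i
  map_smul' c v := coord_smul c v i

theorem sum_coord_smul (he : e ∈ IsManifold.maximalAtlas (𝓡 n) ∞ M) (hx : x ∈ e.source)
    (v : TangentSpace (𝓡 n) x) : ∑ i, coord e v i • coordField e i x = v := by
  have hinj : Function.Injective (mfderiv (𝓡 n) (𝓡 n) e x) :=
    (isInvertible_mfderiv_coordinates he hx).injective
  apply hinj
  rw [map_sum]
  simp only [map_smul, mfderiv_coordField he hx]
  have h := (EuclideanSpace.basisFun (Fin n) ℝ).sum_repr
    (show EuclideanSpace ℝ (Fin n) from mfderiv (𝓡 n) (𝓡 n) e x v)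
  simp only [EuclideanSpace.basisFun_apply] at h
  exact h

theorem mdifferentiableAt_coordinates_symm (he : e ∈ IsManifold.maximalAtlas (𝓡 n) ∞ M)
    (hx : x ∈ e.source) : MDifferentiableAt (𝓡 n) (𝓡 n) e.symm (e x) :=
  (mdifferentiable_of_mem_maximalAtlas' he).mdifferentiableAt_symm (e.map_source hx)

/-- The base point stays `e.symm (e x)` so that both sides have the same type; it can be replaced by
`x` once a differential has been applied and the values are real. -/
theorem mfderiv_coordinates_symm (he : e ∈ IsManifold.maximalAtlas (𝓡 n) ∞ M)
    (hx : x ∈ e.source) (i : Fin n) :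
    mfderiv (𝓡 n) (𝓡 n) e.symm (e x)
      (EuclideanSpace.single i (1 : ℝ) : EuclideanSpace ℝ (Fin n)) =
      coordField e i (e.symm (e x)) := by
  have h := (mdifferentiable_of_mem_maximalAtlas' he).symm_comp_deriv hx
  have h1 := congr($h (coordField e i x))
  rw [ContinuousLinearMap.comp_apply, mfderiv_coordField he hx] at h1
  rw [e.left_inv hx]
  exact h1

theorem partialDeriv_eq (he : e ∈ IsManifold.maximalAtlas (𝓡 n) ∞ M) (hx : x ∈ e.source)
    (i : Fin n) {f : M → ℝ} (hf : MDifferentiableAt (𝓡 n) 𝓘(ℝ, ℝ) f x) :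
    partialDeriv e i f x = mvfderiv (𝓡 n) f x (coordField e i x) := by
  have hf' : MDifferentiableAt (𝓡 n) 𝓘(ℝ, ℝ) f (e.symm (e x)) := by rwa [e.left_inv hx]
  have h := mfderiv_comp (e x) hf' (mdifferentiableAt_coordinates_symm he hx)
  have h1 := congr($h (EuclideanSpace.single i (1 : ℝ) : EuclideanSpace ℝ (Fin n)))
  have h2 := h1.trans (congrArg (mfderiv (𝓡 n) 𝓘(ℝ, ℝ) f (e.symm (e x)))
    (mfderiv_coordinates_symm he hx i))
  rw [e.left_inv hx, mfderiv_eq_fderiv] at h2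
  exact h2

variable [IsManifold (𝓡 n) ∞ M]

theorem smoothFieldAt_coordField (he : e ∈ IsManifold.maximalAtlas (𝓡 n) ∞ M) (hx : x ∈ e.source)
    (i : Fin n) : SmoothFieldAt (coordField e i) x := by
  refine ContMDiffAt.mpullback_vectorField_preimage (n := ∞) ?_ (contMDiffAt_coordinates he hx)
    (isInvertible_mfderiv_coordinates he hx) (by simp)
  exact (contMDiffAt_vectorSpace_iff_contDiffAt.2 contDiffAt_const)

theorem diffFieldAt_coordField (he : e ∈ IsManifold.maximalAtlas (𝓡 n) ∞ M) (hx : x ∈ e.source)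
    (i : Fin n) : DiffFieldAt (coordField e i) x :=
  (smoothFieldAt_coordField he hx i).mdifferentiableAt (by simp)

/-- Pullback commutes with the Lie bracket, and constant fields on Euclidean space commute. -/
theorem mlieBracket_coordField (he : e ∈ IsManifold.maximalAtlas (𝓡 n) ∞ M) (hx : x ∈ e.source)
    (i j : Fin n) : mlieBracket (𝓡 n) (coordField e i) (coordField e j) x = 0 := by
  have : IsManifold (𝓡 n) (minSmoothness ℝ 2) M := by
    rw [minSmoothness_of_isRCLikeNormedField]
    infer_instance
  have hc : ∀ i : Fin n, DiffFieldAt (n := n) (fun z : EuclideanSpace ℝ (Fin n) ↦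
      (EuclideanSpace.single i (1 : ℝ) : EuclideanSpace ℝ (Fin n))) (e x) := fun i ↦
    (contMDiffAt_vectorSpace_iff_contDiffAt.2 (contDiffAt_const (n := ∞))).mdifferentiableAt
      (by simp)
  have h := mpullback_mlieBracket (hc i) (hc j) (contMDiffAt_coordinates he hx)
    (by simpa using ENat.LEInfty.out)
  refine Eq.trans h.symm ?_
  have h0 : mlieBracket (𝓡 n) (fun _ : EuclideanSpace ℝ (Fin n) ↦
      (EuclideanSpace.single i (1 : ℝ) : EuclideanSpace ℝ (Fin n)))
      (fun _ ↦ (EuclideanSpace.single j (1 : ℝ) : EuclideanSpace ℝ (Fin n))) = 0 := by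
    refine (mlieBracketWithin_univ (I := 𝓡 n)).symm.trans
      (mlieBracketWithin_eq_lieBracketWithin.trans ?_)
    funext z
    simp [lieBracketWithin]
    rfl
  rw [h0, mpullback_zero]
  rfl

end Coordinates

/-! ### Derivatives along parallel vector fields -/

section Parallel

variable {n : ℕ} {M : Type*} [TopologicalSpace M] [ChartedSpace (EuclideanSpace ℝ (Fin n)) M]
  {e : OpenPartialHomeomorph M (EuclideanSpace ℝ (Fin n))} {c : ℝ → M} {s : Set ℝ} {t : ℝ}

/-- The velocity within `s` of the curve `c`, computed in the coordinates `e`. -/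
def velocity (e : OpenPartialHomeomorph M (EuclideanSpace ℝ (Fin n))) (c : ℝ → M) (s : Set ℝ)
    (t : ℝ) : TangentSpace (𝓡 n) (c t) :=
  ∑ i, derivWithin (fun r ↦ (e (c r)) i) s t • coordField e i (c t)

theorem hasDerivWithinAt_coordinates (he : e ∈ IsManifold.maximalAtlas (𝓡 n) ∞ M)
    (hce : c t ∈ e.source) (hc : MDifferentiableWithinAt 𝓘(ℝ, ℝ) (𝓡 n) c s t) :
    HasDerivWithinAt (fun r ↦ e (c r)) (derivWithin (fun r ↦ e (c r)) s t) s t := by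
  have h := ((contMDiffAt_coordinates he hce).mdifferentiableAt
    (by simp)).comp_mdifferentiableWithinAt t hc
  exact h.differentiableWithinAt.hasDerivWithinAt

theorem derivWithin_coordinates_apply (he : e ∈ IsManifold.maximalAtlas (𝓡 n) ∞ M)
    (hs : UniqueDiffWithinAt ℝ s t)
    (hce : c t ∈ e.source) (hc : MDifferentiableWithinAt 𝓘(ℝ, ℝ) (𝓡 n) c s t) (i : Fin n) :
    derivWithin (fun r ↦ (e (c r)) i) s t = derivWithin (fun r ↦ e (c r)) s t i :=
  (((EuclideanSpace.proj (𝕜 := ℝ) i).hasFDerivAt.comp_hasDerivWithinAt t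
    (hasDerivWithinAt_coordinates he hce hc)).derivWithin hs)

theorem eventually_mem_source (hce : c t ∈ e.source)
    (hc : MDifferentiableWithinAt 𝓘(ℝ, ℝ) (𝓡 n) c s t) : ∀ᶠ r in 𝓝[s] t, c r ∈ e.source :=
  hc.continuousWithinAt (e.open_source.mem_nhds hce)

theorem hasDerivWithinAt_comp_curve (he : e ∈ IsManifold.maximalAtlas (𝓡 n) ∞ M)
    (hs : UniqueDiffWithinAt ℝ s t)
    (hce : c t ∈ e.source) (hc : MDifferentiableWithinAt 𝓘(ℝ, ℝ) (𝓡 n) c s t)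
    {f : M → ℝ} (hf : MDifferentiableAt (𝓡 n) 𝓘(ℝ, ℝ) f (c t)) :
    HasDerivWithinAt (fun r ↦ f (c r)) (mvfderiv (𝓡 n) f (c t) (velocity e c s t)) s t := by
  have hf' : MDifferentiableAt (𝓡 n) 𝓘(ℝ, ℝ) f (e.symm (e (c t))) := by rwa [e.left_inv hce]
  have h1 : DifferentiableAt ℝ (fun z ↦ f (e.symm z)) (e (c t)) :=
    (hf'.comp (e (c t)) (mdifferentiableAt_coordinates_symm he hce)).differentiableAt
  have h2 := h1.hasFDerivAt.comp_hasDerivWithinAt t (hasDerivWithinAt_coordinates he hce hc)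
  have h3 : mvfderiv (𝓡 n) f (c t) (velocity e c s t) =
      fderiv ℝ (fun z ↦ f (e.symm z)) (e (c t)) (derivWithin (fun r ↦ e (c r)) s t) := by
    conv_rhs => rw [← (EuclideanSpace.basisFun (Fin n) ℝ).sum_repr
      (derivWithin (fun r ↦ e (c r)) s t)]
    rw [map_sum, velocity, map_sum]
    refine Finset.sum_congr rfl fun i _ ↦ ?_
    rw [map_smul, map_smul, ← partialDeriv_eq he hce i hf,
      derivWithin_coordinates_apply he hs hce hc]
    simp [partialDeriv]
  rw [h3]
  refine h2.congr_of_eventuallyEq ?_ (by simp [e.left_inv hce])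
  filter_upwards [eventually_mem_source hce hc] with r hr
  simp [e.left_inv hr]

variable [IsManifold (𝓡 n) ∞ M] {nabla : LinConn n M} {X : ∀ t : ℝ, TangentSpace (𝓡 n) (c t)}

/-- The equation of parallel vector fields, at the parameter `t` and in the coordinates `e`. -/
def IsParallelAt (nabla : LinConn n M) (e : OpenPartialHomeomorph M (EuclideanSpace ℝ (Fin n)))
    (c : ℝ → M) (X : ∀ t : ℝ, TangentSpace (𝓡 n) (c t)) (s : Set ℝ) (t : ℝ) : Prop :=
  ∀ k : Fin n, HasDerivWithinAt (fun r ↦ coord e (X r) k)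
    (-∑ i : Fin n, ∑ j : Fin n, derivWithin (fun r ↦ (e (c r)) i) s t *
      coord e (X t) j * connParam e nabla i j k (c t)) s t

/-- The coordinate-free form of the parallel equation: the derivatives of the components of X
compensate the derivatives of the coordinate fields, as in D X/dt = 0. -/
theorem sum_deriv_smul_coordField (he : e ∈ IsManifold.maximalAtlas (𝓡 n) ∞ M)
    (hce : c t ∈ e.source) :
    ∑ k, (-∑ i : Fin n, ∑ j : Fin n, derivWithin (fun r ↦ (e (c r)) i) s t *
      coord e (X t) j * connParam e nabla i j k (c t)) • coordField e k (c t) =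
    -∑ j, coord e (X t) j • nabla (coordField e j) (c t) (velocity e c s t) := by
  simp only [neg_smul, Finset.sum_neg_distrib, Finset.sum_smul]
  congr 1
  rw [Finset.sum_comm, Finset.sum_congr rfl fun i _ ↦ Finset.sum_comm, Finset.sum_comm]
  refine Finset.sum_congr rfl fun j _ ↦ ?_
  rw [velocity, map_sum, Finset.smul_sum]
  refine Finset.sum_congr rfl fun i _ ↦ ?_
  rw [map_smul, smul_smul, mul_comm (coord e (X t) j)]
  simp only [mul_smul (_ * coord e (X t) j), ← Finset.smul_sum, connParam]
  rw [sum_coord_smul he hce]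

variable [RiemannianBundle (fun x : M ↦ TangentSpace (𝓡 n) x)]
  [IsContMDiffRiemannianBundle (𝓡 n) ∞ (EuclideanSpace ℝ (Fin n))
    (fun x : M ↦ TangentSpace (𝓡 n) x)]

/-- The product rule with its defect term kept, because a compatible connection is not yet known to
be metric when this is applied. -/
theorem mvfderiv_inner (nabla : LinConn n M) {x : M} {Y Z : ∀ x : M, TangentSpace (𝓡 n) x}
    (hY : DiffFieldAt Y x) (hZ : DiffFieldAt Z x) (u : TangentSpace (𝓡 n) x) :
    mvfderiv (𝓡 n) (fun y ↦ inner ℝ (Y y) (Z y)) x u =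
      nabla.derivMetricTensor x (Y x) (Z x) u + inner ℝ (nabla Y x u) (Z x)
        + inner ℝ (Y x) (nabla Z x u) := by
  have h := nabla.derivMetricTensor_apply x hY hZ
    (X := FiberBundle.extend (EuclideanSpace ℝ (Fin n)) u)
  simp only [FiberBundle.extend_apply_self] at h
  rw [h]
  ring

/-- The term with the derivative of X drops out of the product rule. As X lives only along the
curve, it is expanded in coordinate fields, to which the product rule on M applies. -/
theorem hasDerivWithinAt_inner_parallel (he : e ∈ IsManifold.maximalAtlas (𝓡 n) ∞ M)
    (hs : UniqueDiffWithinAt ℝ s t) (hts : t ∈ s)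
    (hce : c t ∈ e.source) (hc : MDifferentiableWithinAt 𝓘(ℝ, ℝ) (𝓡 n) c s t)
    (hX : IsParallelAt nabla e c X s t) {V : ∀ x : M, TangentSpace (𝓡 n) x}
    (hV : DiffFieldAt V (c t)) :
    HasDerivWithinAt (fun r ↦ inner ℝ (V (c r)) (X r))
      (nabla.derivMetricTensor (c t) (V (c t)) (X t) (velocity e c s t)
        + inner ℝ (nabla V (c t) (velocity e c s t)) (X t)) s t := by
  set u := velocity e c s t with hu
  have h1 := HasDerivWithinAt.fun_sum (u := Finset.univ) fun j (_ : j ∈ Finset.univ) ↦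
    (hX j).mul (hasDerivWithinAt_comp_curve he hs hce hc
      (hV.inner (diffFieldAt_coordField he hce j)))
  have h2 : (fun r ↦ inner ℝ (V (c r)) (X r)) =ᶠ[𝓝[s] t] fun r ↦
      ∑ j, coord e (X r) j * inner ℝ (V (c r)) (coordField e j (c r)) := by
    filter_upwards [eventually_mem_source hce hc] with r hr
    conv_lhs => rw [← sum_coord_smul he hr (X r), inner_sum]
    simp only [inner_smul_right]
  refine (h1.congr_of_eventuallyEq_of_mem h2 hts).congr_deriv ?_
  symm
  rw [Finset.sum_add_distrib]
  simp only [← hu, mvfderiv_inner nabla hV (diffFieldAt_coordField he hce _) u, mul_add,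
    Finset.sum_add_distrib]
  have h3 := congrArg (fun w ↦ inner ℝ (V (c t)) w)
    (sum_deriv_smul_coordField (nabla := nabla) (X := X) (s := s) he hce)
  simp only [inner_sum, inner_smul_right, inner_neg_right] at h3
  rw [h3]
  conv_lhs => rw [← sum_coord_smul he hce (X t)]
  simp only [map_sum, map_smul, inner_sum, inner_smul_right, ← hu,
    sum_apply, smul_apply, smul_eq_mul]
  ring

set_option synthInstance.maxHeartbeats 200000 in
theorem hasDerivWithinAt_inner_parallel_self (he : e ∈ IsManifold.maximalAtlas (𝓡 n) ∞ M)
    (hs : UniqueDiffWithinAt ℝ s t) (hts : t ∈ s)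
    (hce : c t ∈ e.source) (hc : MDifferentiableWithinAt 𝓘(ℝ, ℝ) (𝓡 n) c s t)
    (hX : IsParallelAt nabla e c X s t) :
    HasDerivWithinAt (fun r ↦ inner ℝ (X r) (X r))
      (nabla.derivMetricTensor (c t) (X t) (X t) (velocity e c s t)) s t := by
  set u := velocity e c s t with hu
  -- Only one of the two factors X is expanded; the scalar products of the other with the coordinate
  -- fields are covered by the previous lemma.
  have h1 := HasDerivWithinAt.fun_sum (u := Finset.univ) fun j (_ : j ∈ Finset.univ) ↦
    (hX j).mul (hasDerivWithinAt_inner_parallel he hs hts hce hc hX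
      (diffFieldAt_coordField he hce j))
  have h2 : (fun r ↦ inner ℝ (X r) (X r)) =ᶠ[𝓝[s] t] fun r ↦
      ∑ j, coord e (X r) j * inner ℝ (coordField e j (c r)) (X r) := by
    filter_upwards [eventually_mem_source hce hc] with r hr
    conv_lhs => enter [2]; rw [← sum_coord_smul he hr (X r)]
    rw [sum_inner]
    simp only [real_inner_smul_left]
  refine (h1.congr_of_eventuallyEq_of_mem h2 hts).congr_deriv ?_
  symm
  rw [Finset.sum_add_distrib]
  simp only [← hu, mul_add, Finset.sum_add_distrib]
  have h3 := congrArg (fun w ↦ inner ℝ w (X t))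
    (sum_deriv_smul_coordField (nabla := nabla) (X := X) (s := s) he hce)
  simp only [sum_inner, real_inner_smul_left, inner_neg_left] at h3
  rw [h3]
  have h4 := congrArg (nabla.derivMetricTensor (c t)) (sum_coord_smul he hce (X t))
  simp only [map_sum, map_smul] at h4
  conv_lhs => rw [← h4]
  simp only [← hu, sum_apply, smul_apply, smul_eq_mul]
  ring

end Parallel

/-! ### Compatible connections are the metric ones with parallel dual vector field -/

theorem eq_of_hasDerivWithinAt_zero {f : ℝ → ℝ}
    (hf : ∀ t ∈ Icc (0 : ℝ) 1, HasDerivWithinAt f 0 (Icc 0 1) t) {t : ℝ} (ht : t ∈ Icc (0 : ℝ) 1) :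
    f t = f 0 := by
  refine constant_of_derivWithin_zero (fun t ht ↦ (hf t ht).differentiableWithinAt)
    (fun t ht ↦ (hf t (Ico_subset_Icc_self ht)).derivWithin ?_) t ht
  exact (uniqueDiffOn_Icc zero_lt_one) t (Ico_subset_Icc_self ht)

section Compatible

variable {n : ℕ} {M : Type*} [TopologicalSpace M] [ChartedSpace (EuclideanSpace ℝ (Fin n)) M]
  [IsManifold (𝓡 n) ∞ M] [RiemannianBundle (fun x : M ↦ TangentSpace (𝓡 n) x)]
  {β : ∀ x : M, TangentSpace (𝓡 n) x →L[ℝ] ℝ} {F : TangentBundle (𝓡 n) M → ℝ}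

theorem inner_sharp (β : ∀ x : M, TangentSpace (𝓡 n) x →L[ℝ] ℝ) (x : M)
    (v : TangentSpace (𝓡 n) x) : inner ℝ (sharp β x) v = β x v := by
  have := completeSpace_tangent (n := n) x
  simp [sharp]

theorem IsRandersMetric.apply_eq (hF : IsRandersMetric F β) (x : M) (v : TangentSpace (𝓡 n) x) :
    F ⟨x, v⟩ = √(inner ℝ v v) + inner ℝ (sharp β x) v := by
  rw [hF.eq_add, inner_sharp, norm_eq_sqrt_real_inner]

variable [IsContMDiffRiemannianBundle (𝓡 n) ∞ (EuclideanSpace ℝ (Fin n))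
    (fun x : M ↦ TangentSpace (𝓡 n) x)]

theorem smoothFieldAt_sharp (hF : IsRandersMetric F β) (x : M) : SmoothFieldAt (sharp β) x := by
  refine contMDiffAt_of_inner_frame fun i ↦ ?_
  simp only [inner_sharp]
  have : ContMDiffAt (𝓡 n) ((𝓡 n).prod 𝓘(ℝ)) ∞
      (fun m ↦ TotalSpace.mk' ℝ (E := Bundle.Trivial M ℝ) m (β m (frame x i m))) x :=
    ContMDiffAt.clm_bundle_apply (F₁ := EuclideanSpace ℝ (Fin n)) (hF.smooth_form x)
      (contMDiffAt_frame (mem_frameDomain x) i)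
  exact (contMDiffAt_totalSpace.1 this).2

theorem diffFieldAt_sharp (hF : IsRandersMetric F β) (x : M) : DiffFieldAt (sharp β) x :=
  (smoothFieldAt_sharp hF x).mdifferentiableAt (by simp)

/-- F(X) depends only on ⟨X, X⟩ and ⟨V, X⟩, and both have zero derivative along a parallel field. -/
theorem isCompatible_of_metric (hF : IsRandersMetric F β) {nabla : LinConn n M}
    (hs : nabla.ContMDiffCovariantDerivative ∞) (hm : nabla.IsMetricCompatible)
    (hV : ∀ x, nabla (sharp β) x = 0) : IsCompatible nabla F where
  smooth := hs
  parallel := by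
    intro c X hc hX t ht
    have hm' : ∀ x, nabla.derivMetricTensor x = 0 := fun x ↦ congr_fun hm x
    have h1 : inner ℝ (X t) (X t) = inner ℝ (X 0) (X 0) := by
      refine eq_of_hasDerivWithinAt_zero (f := fun r ↦ inner ℝ (X r) (X r)) (fun t ht ↦ ?_) ht
      obtain ⟨e, he, hce, hX⟩ := hX t ht
      have := hasDerivWithinAt_inner_parallel_self he (uniqueDiffOn_Icc zero_lt_one t ht) ht hce
        ((hc t ht).mdifferentiableWithinAt (by simp)) hX
      simpa [hm'] using this
    have h2 : inner ℝ (sharp β (c t)) (X t) = inner ℝ (sharp β (c 0)) (X 0) := by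
      refine eq_of_hasDerivWithinAt_zero (f := fun r ↦ inner ℝ (sharp β (c r)) (X r))
        (fun t ht ↦ ?_) ht
      obtain ⟨e, he, hce, hX⟩ := hX t ht
      have := hasDerivWithinAt_inner_parallel he (uniqueDiffOn_Icc zero_lt_one t ht) ht hce
        ((hc t ht).mdifferentiableWithinAt (by simp)) hX (diffFieldAt_sharp hF (c t))
      simpa [hm', hV] using this
    rw [hF.apply_eq, hF.apply_eq, h1, h2]

end Compatible

/-! ### Existence of parallel vector fields -/

section Existence

variable {n : ℕ} {M : Type*} [TopologicalSpace M] [ChartedSpace (EuclideanSpace ℝ (Fin n)) M]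
  {e : OpenPartialHomeomorph M (EuclideanSpace ℝ (Fin n))} {x : M}

theorem coord_eq_mvfderiv (he : e ∈ IsManifold.maximalAtlas (𝓡 n) ∞ M)
    (hx : x ∈ e.source) (v : TangentSpace (𝓡 n) x) (k : Fin n) :
    coord e v k = mvfderiv (𝓡 n) (fun y ↦ e y k) x v := by
  have h := mfderiv_comp (I := 𝓡 n) (I' := 𝓡 n) (I'' := 𝓘(ℝ, ℝ)) x
    (g := (EuclideanSpace.proj k : EuclideanSpace ℝ (Fin n) →L[ℝ] ℝ))
    (EuclideanSpace.proj k : EuclideanSpace ℝ (Fin n) →L[ℝ] ℝ).mdifferentiableAt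
    ((contMDiffAt_coordinates he hx).mdifferentiableAt (by simp))
  have h1 := congr($h v)
  rw [ContinuousLinearMap.mfderiv_eq] at h1
  exact h1.symm

variable [IsManifold (𝓡 n) ∞ M] {nabla : LinConn n M}

theorem contMDiffAt_connParam [T2Space M] (hs : nabla.ContMDiffCovariantDerivative ∞)
    (he : e ∈ IsManifold.maximalAtlas (𝓡 n) ∞ M) (hx : x ∈ e.source) (i j k : Fin n) :
    ContMDiffAt (𝓡 n) 𝓘(ℝ, ℝ) ∞ (connParam e nabla i j k) x := by
  have h1 : SmoothHomAt (nabla (coordField e j)) x :=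
    contMDiffAt_covariantDerivative hs (e.open_source.mem_nhds hx)
      fun y hy ↦ smoothFieldAt_coordField he hy j
  have h2 : SmoothFieldAt (fun y ↦ nabla (coordField e j) y (coordField e i y)) x :=
    ContMDiffAt.clm_bundle_apply h1 (smoothFieldAt_coordField he hx i)
  have h3 : ContMDiffAt (𝓡 n) 𝓘(ℝ, ℝ) ∞ (fun y ↦ e y k) x :=
    (EuclideanSpace.proj k : EuclideanSpace ℝ (Fin n) →L[ℝ] ℝ).contMDiff.contMDiffAt.comp x
      (contMDiffAt_coordinates he hx)
  refine (contMDiffAt_mvfderiv h3 h2).congr_of_eventuallyEq ?_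
  filter_upwards [e.open_source.mem_nhds hx] with y hy
  exact coord_eq_mvfderiv he hy _ k

theorem contDiffAt_connParam [T2Space M] (hs : nabla.ContMDiffCovariantDerivative ∞)
    (he : e ∈ IsManifold.maximalAtlas (𝓡 n) ∞ M) (hx : x ∈ e.source) (i j k : Fin n) :
    ContDiffAt ℝ ∞ (fun z ↦ connParam e nabla i j k (e.symm z)) (e x) := by
  rw [← contMDiffAt_iff_contDiffAt]
  have h := contMDiffAt_connParam hs he hx i j k
  rw [← e.left_inv hx] at h
  exact h.comp (e x) (contMDiffAt_symm_of_mem_maximalAtlas he (e.map_source hx))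

/-- Local existence of solutions of the equation of parallel vector fields along the coordinate
line through `x` with direction `w`. -/
theorem exists_parallel_coordinates [T2Space M] (hs : nabla.ContMDiffCovariantDerivative ∞)
    (he : e ∈ IsManifold.maximalAtlas (𝓡 n) ∞ M) (hx : x ∈ e.source)
    (w v : EuclideanSpace ℝ (Fin n)) :
    ∃ δ > 0, ∃ ξ : ℝ → EuclideanSpace ℝ (Fin n), ξ 0 = v ∧ ∀ r ∈ Icc (0 : ℝ) 1,
      e x + (δ * r) • w ∈ e.target ∧ ∀ k, HasDerivAt (fun r ↦ ξ r k)
        (-∑ i, ∑ j, δ * w i * ξ r j * connParam e nabla i j k (e.symm (e x + (δ * r) • w))) r := by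
  -- Position and vector together solve an autonomous system, so the Picard–Lindelöf theorem for a
  -- C¹ vector field applies.
  let f : EuclideanSpace ℝ (Fin n) × EuclideanSpace ℝ (Fin n) →
      EuclideanSpace ℝ (Fin n) × EuclideanSpace ℝ (Fin n) := fun z ↦
    (w, WithLp.toLp 2 fun k ↦ -∑ i, ∑ j, w i * z.2 j * connParam e nabla i j k (e.symm z.1))
  have hf : ContDiffAt ℝ 1 f (e x, v) := by
    refine contDiffAt_const.prodMk ((contDiffAt_euclidean (𝕜 := ℝ)).2 fun k ↦ ?_)
    refine (ContDiffAt.sum fun i _ ↦ ContDiffAt.sum fun j _ ↦ ?_).neg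
    refine ContDiffAt.mul (contDiffAt_const.mul ?_) ?_
    · exact (EuclideanSpace.proj j : EuclideanSpace ℝ (Fin n) →L[ℝ] ℝ).contDiff.contDiffAt.comp
        (e x, v) contDiffAt_snd
    · exact ((contDiffAt_connParam hs he hx i j k).of_le (m := 1) ENat.LEInfty.out).comp (e x, v)
        contDiffAt_fst
  obtain ⟨α, hα0, ε, hε, hα⟩ :=
    hf.exists_forall_mem_closedBall_exists_eq_forall_mem_Ioo_hasDerivAt₀ 0
  simp only [zero_sub, zero_add] at hα
  -- The position component has constant velocity `w`, so it runs along the coordinate line.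
  have hα1 : ∀ t ∈ Ioo (-ε) ε, (α t).1 = e x + t • w := by
    intro t ht
    have hd : ∀ t ∈ Ioo (-ε) ε, HasDerivAt (fun t ↦ (α t).1 - t • w) 0 t := fun t ht ↦ by
      have h1 := ((ContinuousLinearMap.fst ℝ _ _).hasFDerivAt.comp_hasDerivAt t (hα t ht)).sub
        ((hasDerivAt_id t).smul_const w)
      exact h1.congr_deriv (by simp [f])
    have := isOpen_Ioo.is_const_of_deriv_eq_zero isPreconnected_Ioo
      (fun t ht ↦ (hd t ht).differentiableAt.differentiableWithinAt)
      (fun t ht ↦ (hd t ht).deriv) ht (show (0 : ℝ) ∈ Ioo (-ε) ε from ⟨by linarith, hε⟩)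
    simp only [hα0, zero_smul, sub_zero] at this
    rw [← this]
    simp
  have hcont : Continuous fun t : ℝ ↦ e x + t • w := by fun_prop
  have hmem : {t : ℝ | e x + t • w ∈ e.target} ∈ 𝓝 (0 : ℝ) :=
    hcont.continuousAt (e.open_target.mem_nhds (by simpa using e.map_source hx))
  obtain ⟨ρ, hρ, hball⟩ := Metric.mem_nhds_iff.1 hmem
  -- Time is rescaled so that all of [0, 1] fits into the life span `ε` of the solution and keeps
  -- the line in the chart (`ρ`); the factor 1/2 makes the inequalities strict at the endpoint 1.
  refine ⟨min ε ρ / 2, by positivity, fun r ↦ (α (min ε ρ / 2 * r)).2, by simp [hα0],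
    fun r hr ↦ ?_⟩
  have h0 : 0 ≤ min ε ρ / 2 * r := by have := hr.1; positivity
  have hpos : 0 < min ε ρ := by positivity
  have h1 : min ε ρ / 2 * r < min ε ρ := by nlinarith [hr.2]
  have h2 : min ε ρ / 2 * r ∈ Ioo (-ε) ε :=
    ⟨by linarith, h1.trans_le (min_le_left _ _)⟩
  refine ⟨hball (by
    rw [Metric.mem_ball, dist_zero_right, Real.norm_of_nonneg h0]
    exact h1.trans_le (min_le_right _ _)), fun k ↦ ?_⟩
  have h3 := (ContinuousLinearMap.snd ℝ _ _).hasFDerivAt.comp_hasDerivAt _ (hα _ h2)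
  have h4 := (EuclideanSpace.proj k : EuclideanSpace ℝ (Fin n) →L[ℝ] ℝ).hasFDerivAt.comp_hasDerivAt
    _ h3
  have h5 := h4.comp r ((hasDerivAt_id r).const_mul (min ε ρ / 2))
  refine h5.congr_deriv ?_
  simp only [f, hα1 _ h2, PiLp.proj_apply, mul_one, ContinuousLinearMap.coe_snd', neg_mul,
    Finset.sum_mul]
  congr 1
  refine Finset.sum_congr rfl fun i _ ↦ Finset.sum_congr rfl fun j _ ↦ ?_
  ring

/-- There is a parallel vector field along a smooth curve with given initial value, and given
initial direction of the curve. -/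
theorem exists_isParallelAt [T2Space M] (hs : nabla.ContMDiffCovariantDerivative ∞)
    (he : e ∈ IsManifold.maximalAtlas (𝓡 n) ∞ M) (hx : x ∈ e.source)
    (w v : EuclideanSpace ℝ (Fin n)) :
    ∃ (c : ℝ → M) (X : ∀ t : ℝ, TangentSpace (𝓡 n) (c t)) (δ : ℝ),
      ContMDiffOn 𝓘(ℝ, ℝ) (𝓡 n) ∞ c (Icc 0 1) ∧ 0 < δ ∧ c 0 = x ∧
      (∀ t ∈ Icc (0 : ℝ) 1, c t ∈ e.source ∧ IsParallelAt nabla e c X (Icc 0 1) t) ∧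
      (∀ k, coord e (X 0) k = v k) ∧
      ∀ i, derivWithin (fun r ↦ (e (c r)) i) (Icc 0 1) 0 = δ * w i := by
  obtain ⟨δ, hδ, ξ, hξ0, hξ⟩ := exists_parallel_coordinates hs he hx w v
  let c : ℝ → M := fun r ↦ e.symm (e x + (δ * r) • w)
  have hc : ∀ t ∈ Icc (0 : ℝ) 1, c t ∈ e.source := fun t ht ↦ e.map_target (hξ t ht).1
  have hcoord : ∀ t ∈ Icc (0 : ℝ) 1, ∀ k,
      coord e (∑ j, ξ t j • coordField e j (c t)) k = ξ t k := by
    intro t ht k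
    rw [← show coordL e (c t) k _ = coord e _ k from rfl, map_sum]
    simp only [map_smul]
    simp only [show ∀ v, coordL e (c t) k v = coord e v k from fun _ ↦ rfl,
      coord_coordField he (hc t ht)]
    simp
  have hder : ∀ t ∈ Icc (0 : ℝ) 1, ∀ i,
      derivWithin (fun r ↦ (e (c r)) i) (Icc 0 1) t = δ * w i := by
    intro t ht i
    have h1 : HasDerivAt (fun r ↦ e x i + (δ * r) * w i) (δ * w i) t := by
      simpa using (((hasDerivAt_id t).const_mul δ).mul_const (w i)).const_add (e x i)
    refine (h1.hasDerivWithinAt.congr (fun r hr ↦ ?_) ?_).derivWithin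
      (uniqueDiffOn_Icc zero_lt_one t ht)
    · simp [c, e.right_inv (hξ r hr).1]
    · simp [c, e.right_inv (hξ t ht).1]
  have hmem0 : (0 : ℝ) ∈ Icc (0 : ℝ) 1 := by simp
  refine ⟨c, fun t ↦ ∑ j, ξ t j • coordField e j (c t), δ, ?_, hδ, ?_, fun t ht ↦
    ⟨hc t ht, fun k ↦ ?_⟩, fun k ↦ ?_, hder 0 hmem0⟩
  · intro t ht
    refine ((contMDiffAt_symm_of_mem_maximalAtlas he (hξ t ht).1).comp t ?_).contMDiffWithinAt
    refine ContDiffAt.contMDiffAt ?_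
    fun_prop
  · simp [c, e.left_inv hx]
  · have h1 := ((hξ t ht).2 k).hasDerivWithinAt (s := Icc 0 1)
    refine (h1.congr (fun r hr ↦ hcoord r hr k) (hcoord t ht k)).congr_deriv ?_
    simp only [hder t ht, hcoord t ht]
    rfl
  · rw [hcoord 0 hmem0, hξ0]

end Existence

/-! ### Necessary conditions on a compatible connection -/

section Characterization

variable {n : ℕ} {M : Type*} [TopologicalSpace M] [ChartedSpace (EuclideanSpace ℝ (Fin n)) M]
  [IsManifold (𝓡 n) ∞ M] {nabla : LinConn n M}

theorem IsParallelAt.neg {e : OpenPartialHomeomorph M (EuclideanSpace ℝ (Fin n))} {c : ℝ → M}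
    {X : ∀ t : ℝ, TangentSpace (𝓡 n) (c t)} {s : Set ℝ} {t : ℝ}
    (h : IsParallelAt nabla e c X s t) : IsParallelAt nabla e c (fun t ↦ -X t) s t := by
  have hneg : ∀ (r : ℝ) (k : Fin n), coord e (-X r) k = -coord e (X r) k := fun r k ↦ by
    rw [← neg_one_smul ℝ, coord_smul, neg_one_mul]
  intro k
  simp only [hneg]
  refine (h k).neg.congr_deriv ?_
  simp

theorem isLocallyConstant_of_mvfderiv_eq_zero {f : M → ℝ}
    (hf : ∀ x, MDifferentiableAt (𝓡 n) 𝓘(ℝ, ℝ) f x) (h : ∀ x, mvfderiv (𝓡 n) f x = 0) :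
    IsLocallyConstant f := by
  rw [IsLocallyConstant.iff_eventually_eq]
  intro x
  set e := chartAt (EuclideanSpace ℝ (Fin n)) x
  have he : e ∈ IsManifold.maximalAtlas (𝓡 n) ∞ M := IsManifold.chart_mem_maximalAtlas x
  have hx : x ∈ e.source := mem_chart_source (EuclideanSpace ℝ (Fin n)) x
  have hd : ∀ y ∈ e.source, HasFDerivAt (fun z ↦ f (e.symm z)) 0 (e y) := fun y hy ↦ by
    have h1 : DifferentiableAt ℝ (fun z ↦ f (e.symm z)) (e y) :=
      (MDifferentiableAt.comp (e y) (hf _)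
        (mdifferentiableAt_coordinates_symm he hy)).differentiableAt
    refine h1.hasFDerivAt.congr_fderiv ?_
    refine ContinuousLinearMap.coe_injective
      ((EuclideanSpace.basisFun (Fin n) ℝ).toBasis.ext fun i ↦ ?_)
    have h2 := partialDeriv_eq he hy i (hf y)
    rw [h y] at h2
    simpa [partialDeriv] using h2
  obtain ⟨ρ, hρ, hball⟩ := Metric.isOpen_iff.1 e.open_target (e x) (e.map_source hx)
  have hd' : ∀ z ∈ Metric.ball (e x) ρ, HasFDerivAt (fun z ↦ f (e.symm z)) 0 z := fun z hz ↦ by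
    simpa [e.right_inv (hball hz)] using hd (e.symm z) (e.map_target (hball hz))
  have hmem : e ⁻¹' Metric.ball (e x) ρ ∈ 𝓝 x :=
    (e.continuousAt hx) (Metric.ball_mem_nhds _ hρ)
  filter_upwards [hmem, e.open_source.mem_nhds hx] with y hy hys
  have := Metric.isOpen_ball.is_const_of_fderiv_eq_zero (convex_ball (e x) ρ).isPreconnected
    (fun z hz ↦ (hd' z hz).differentiableAt.differentiableWithinAt)
    (fun z hz ↦ (hd' z hz).fderiv) hy (Metric.mem_ball_self hρ)
  simpa [e.left_inv hys, e.left_inv hx] using this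

variable [RiemannianBundle (fun x : M ↦ TangentSpace (𝓡 n) x)]
  {β : ∀ x : M, TangentSpace (𝓡 n) x →L[ℝ] ℝ} {F : TangentBundle (𝓡 n) M → ℝ}
  [IsContMDiffRiemannianBundle (𝓡 n) ∞ (EuclideanSpace ℝ (Fin n))
    (fun x : M ↦ TangentSpace (𝓡 n) x)]

theorem derivMetricTensor_symm (nabla : LinConn n M) {x : M} (v w u : TangentSpace (𝓡 n) x) :
    nabla.derivMetricTensor x v w u = nabla.derivMetricTensor x w v u := by
  rw [CovariantDerivative.derivMetricTensor_apply_eq_extend,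
    CovariantDerivative.derivMetricTensor_apply_eq_extend]
  simp only [real_inner_comm]
  ring

/-- Comparing F on X and on −X separates the Riemannian part from the 1-form, and both constants are
then differentiated at time 0. The point `y` is the start of the curve, equal to `x` only
propositionally; coordinates identify the vectors without transporting them. -/
theorem IsCompatible.exists_derivMetricTensor_eq_zero [T2Space M] (hF : IsRandersMetric F β)
    (h : IsCompatible nabla F) {e : OpenPartialHomeomorph M (EuclideanSpace ℝ (Fin n))}
    (he : e ∈ IsManifold.maximalAtlas (𝓡 n) ∞ M) {x : M} (hx : x ∈ e.source)
    (w v : EuclideanSpace ℝ (Fin n)) :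
    ∃ (y : M) (u z : TangentSpace (𝓡 n) y), y = x ∧ (∀ k, coord e u k = w k) ∧
      (∀ k, coord e z k = v k) ∧ nabla.derivMetricTensor y z z u = 0 ∧
      nabla.derivMetricTensor y (sharp β y) z u + inner ℝ (nabla (sharp β) y u) z = 0 := by
  obtain ⟨c, X, δ, hc, hδ, hc0, hX, hX0, hder⟩ := exists_isParallelAt h.smooth he hx w v
  have hmem0 : (0 : ℝ) ∈ Icc (0 : ℝ) 1 := by simp
  have huniq := uniqueDiffOn_Icc (zero_lt_one (α := ℝ)) 0 hmem0
  have hFX := h.parallel c X hc fun t ht ↦ ⟨e, he, (hX t ht).1, (hX t ht).2⟩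
  have hFX' := h.parallel c (fun t ↦ -X t) hc
    fun t ht ↦ ⟨e, he, (hX t ht).1, (hX t ht).2.neg⟩
  simp only [hF.apply_eq, inner_neg_left, inner_neg_right, neg_neg] at hFX hFX'
  have h1 : ∀ t ∈ Icc (0 : ℝ) 1, inner ℝ (X t) (X t) = inner ℝ (X 0) (X 0) := fun t ht ↦ by
    have := hFX t ht
    have := hFX' t ht
    exact (Real.sqrt_inj real_inner_self_nonneg real_inner_self_nonneg).1 (by linarith)
  have h2 : ∀ t ∈ Icc (0 : ℝ) 1, inner ℝ (sharp β (c t)) (X t) = inner ℝ (sharp β (c 0)) (X 0) :=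
    fun t ht ↦ by linarith [hFX t ht, hFX' t ht]
  have hc' := (hc 0 hmem0).mdifferentiableWithinAt (by simp)
  have hv : ∃ u : TangentSpace (𝓡 n) (c 0), velocity e c (Icc 0 1) 0 = δ • u ∧
      ∀ k, coord e u k = w k := by
    refine ⟨∑ i, w i • coordField e i (c 0), ?_, fun k ↦ ?_⟩
    · simp only [velocity, hder, Finset.smul_sum, mul_smul]
    · rw [← show coordL e (c 0) k _ = coord e _ k from rfl, map_sum]
      simp only [map_smul]
      simp only [show ∀ v, coordL e (c 0) k v = coord e v k from fun _ ↦ rfl,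
        coord_coordField he (hX 0 hmem0).1]
      simp
  obtain ⟨u, hu, huw⟩ := hv
  have h3 := hasDerivWithinAt_inner_parallel_self he huniq hmem0 (hX 0 hmem0).1 hc' (hX 0 hmem0).2
  have h4 := hasDerivWithinAt_inner_parallel he huniq hmem0 (hX 0 hmem0).1 hc' (hX 0 hmem0).2
    (diffFieldAt_sharp hF (c 0))
  have h5 := huniq.eq_deriv _ h3 ((hasDerivWithinAt_const 0 _ _).congr h1 rfl)
  have h6 := huniq.eq_deriv _ h4 ((hasDerivWithinAt_const 0 _ _).congr h2 rfl)
  rw [hu] at h5 h6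
  -- The initial velocity is only a multiple `δ • u` of the prescribed one, and the positive factor
  -- cancels.
  simp only [map_smul, smul_eq_mul, inner_smul_left, RCLike.conj_to_real, ← mul_add,
    mul_eq_zero, hδ.ne', false_or] at h5 h6
  exact ⟨c 0, u, X 0, hc0, huw, hX0, h5, h6⟩

theorem IsCompatible.derivMetricTensor_eq_zero [T2Space M] (hF : IsRandersMetric F β)
    (h : IsCompatible nabla F) {x : M} (u z : TangentSpace (𝓡 n) x) :
    nabla.derivMetricTensor x z z u = 0 ∧
      nabla.derivMetricTensor x (sharp β x) z u + inner ℝ (nabla (sharp β) x u) z = 0 := by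
  have he := IsManifold.chart_mem_maximalAtlas (I := 𝓡 n) (n := ∞) x
  have hx := mem_chart_source (EuclideanSpace ℝ (Fin n)) x
  obtain ⟨y, u', z', rfl, hu, hz, h1, h2⟩ := h.exists_derivMetricTensor_eq_zero hF he hx
    (WithLp.toLp 2 (coord (chartAt _ x) u)) (WithLp.toLp 2 (coord (chartAt _ x) z))
  have hu' : u' = u := by
    rw [← sum_coord_smul he hx u', ← sum_coord_smul he hx u]
    simp only [hu]
  have hz' : z' = z := by
    rw [← sum_coord_smul he hx z', ← sum_coord_smul he hx z]
    simp only [hz]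
  rw [← hu', ← hz']
  exact ⟨h1, h2⟩

set_option synthInstance.maxHeartbeats 200000 in
theorem IsCompatible.isMetricCompatible [T2Space M] (hF : IsRandersMetric F β)
    (h : IsCompatible nabla F) : nabla.IsMetricCompatible := by
  funext x
  refine ContinuousLinearMap.ext fun v ↦ ContinuousLinearMap.ext fun w ↦
    ContinuousLinearMap.ext fun u ↦ ?_
  -- Polarization: a symmetric form that vanishes on the diagonal is zero.
  have h1 := (h.derivMetricTensor_eq_zero hF u (v + w)).1
  simp only [map_add, add_apply, (h.derivMetricTensor_eq_zero hF u v).1,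
    (h.derivMetricTensor_eq_zero hF u w).1, derivMetricTensor_symm nabla w v u] at h1
  simp only [Pi.zero_apply, zero_apply]
  linarith

theorem IsCompatible.sharp_parallel [T2Space M] (hF : IsRandersMetric F β)
    (h : IsCompatible nabla F) (x : M) : nabla (sharp β) x = 0 := by
  ext1 u
  refine ext_inner_right ℝ fun z ↦ ?_
  have h1 := (h.derivMetricTensor_eq_zero hF u z).2
  rw [congr_fun (h.isMetricCompatible hF) x] at h1
  simpa using h1

/-- The length of the dual vector field is constant if there is a compatible connection. -/
theorem IsCompatible.norm_sharp_eq [T2Space M] [ConnectedSpace M] (hF : IsRandersMetric F β)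
    (h : IsCompatible nabla F) (x y : M) : ‖sharp β x‖ = ‖sharp β y‖ := by
  have hsq : IsLocallyConstant fun x ↦ inner ℝ (sharp β x) (sharp β x) := by
    refine isLocallyConstant_of_mvfderiv_eq_zero
      (fun x ↦ (diffFieldAt_sharp hF x).inner (diffFieldAt_sharp hF x)) fun x ↦ ?_
    refine ContinuousLinearMap.ext fun u ↦ ?_
    rw [mvfderiv_inner nabla (diffFieldAt_sharp hF x) (diffFieldAt_sharp hF x),
      congr_fun (h.isMetricCompatible hF) x, h.sharp_parallel hF]
    simp
  have := hsq.apply_eq_of_preconnectedSpace x y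
  rw [norm_eq_sqrt_real_inner, norm_eq_sqrt_real_inner, this]

/-- The dual vector field of a Randers metric that is not Riemannian does not vanish identically. -/
theorem isRiemannianNorm_of_sharp_eq_zero (hF : IsRandersMetric F β) (h : ∀ x, sharp β x = 0) :
    IsRiemannianNorm F := by
  obtain ⟨g, hg, hinner⟩ := IsContMDiffRiemannianBundle.exists_contMDiff (IB := 𝓡 n) (n := ∞)
    (F := EuclideanSpace ℝ (Fin n)) (E := fun x : M ↦ TangentSpace (𝓡 n) x)
  refine ⟨⟨g, fun x v w ↦ ?_, fun x v hv ↦ ?_, fun x ↦ ?_, hg⟩, fun x v ↦ ?_⟩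
  · rw [← hinner, ← hinner, real_inner_comm]
  · rw [← hinner]
    exact real_inner_self_pos.2 hv
  · simp only [← hinner]
    exact RiemannianBundle.g.isVonNBounded x
  · rw [hF.apply_eq, h, inner_zero_left, add_zero, hinner]

end Characterization

/-! ### Linear algebra of torsion tensors -/

section Algebra

variable {W : Type*} [NormedAddCommGroup W] [InnerProductSpace ℝ W]
  {V : W} {T A : W →L[ℝ] W →L[ℝ] W}

/-- The conditions on the torsion `T` that characterize the extremal compatible connection, where
`V` is the dual vector of the 1-form. -/
structure IsExtremalTensor (V : W) (T : W →L[ℝ] W →L[ℝ] W) : Prop where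
  inner_eq_zero : ∀ x y z, inner ℝ V x = 0 → inner ℝ V y = 0 → inner ℝ V z = 0 →
    inner ℝ (T x y) z = 0
  inner_symm : ∀ y z, inner ℝ V y = 0 → inner ℝ V z = 0 →
    inner ℝ (T V y) z = inner ℝ (T V z) y

/-- Differences of compatible connections: `A y x` stands for `∇'_x y - ∇_x y`. -/
structure IsDifferenceTensor (V : W) (A : W →L[ℝ] W →L[ℝ] W) : Prop where
  skew : ∀ x y z, inner ℝ (A y x) z = -inner ℝ (A z x) y
  apply_eq_zero : A V = 0

theorem IsDifferenceTensor.inner_eq_zero (hA : IsDifferenceTensor V A) (x y : W) :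
    inner ℝ (A y x) V = 0 := by
  rw [hA.skew, hA.apply_eq_zero]
  simp

/-- The component orthogonal to `V`. -/
def orthComp (V x : W) : W := x - (inner ℝ V x / inner ℝ V V) • V

theorem inner_orthComp (hV : V ≠ 0) (x : W) : inner ℝ V (orthComp V x) = 0 := by
  have := (real_inner_self_pos.2 hV).ne'
  rw [orthComp, inner_sub_right, real_inner_smul_right]
  field_simp
  ring

theorem orthComp_add_smul (V x : W) : orthComp V x + (inner ℝ V x / inner ℝ V V) • V = x := by
  simp [orthComp]

theorem inner_orthComp_right {V w : W} (hw : inner ℝ w V = 0) (x : W) :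
    inner ℝ w (orthComp V x) = inner ℝ w x := by
  simp [orthComp, inner_sub_right, real_inner_smul_right, hw]

variable {ι : Type*} [Fintype ι] (b : OrthonormalBasis ι ℝ W)

/-- Symmetric and skew-symmetric matrices are orthogonal. -/
theorem sum_inner_eq_zero_of_symm_skew {S K : W → W}
    (hS : ∀ x y, inner ℝ (S x) y = inner ℝ (S y) x)
    (hK : ∀ x y, inner ℝ (K x) y = -inner ℝ (K y) x) : ∑ j, inner ℝ (S (b j)) (K (b j)) = 0 := by
  have h1 : ∀ j, inner ℝ (S (b j)) (K (b j)) =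
      ∑ k, inner ℝ (S (b j)) (b k) * inner ℝ (K (b j)) (b k) := fun j ↦ by
    rw [← b.sum_inner_mul_inner]
    simp only [real_inner_comm (K _)]
  have h2 : ∑ j, ∑ k, inner ℝ (S (b j)) (b k) * inner ℝ (K (b j)) (b k) =
      -∑ j, ∑ k, inner ℝ (S (b j)) (b k) * inner ℝ (K (b j)) (b k) := by
    conv_lhs => rw [Finset.sum_comm]
    simp only [← Finset.sum_neg_distrib]
    refine Finset.sum_congr rfl fun j _ ↦ Finset.sum_congr rfl fun k _ ↦ ?_
    rw [hS (b k), hK (b k)]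
    ring
  simp only [h1]
  linarith

theorem sum_inner_smul_self (V : W) : ∑ i, inner ℝ V (b i) • b i = V := by
  simpa [real_inner_comm] using b.sum_repr' V

/-- The torsion of an extremal compatible connection is orthogonal to the alternation of the
difference tensors. -/
theorem IsExtremalTensor.sum_inner_eq_zero (hV : V ≠ 0) (hT : IsExtremalTensor V T)
    (hA : IsDifferenceTensor V A) : ∑ i, ∑ j, inner ℝ (T (b i) (b j)) (A (b j) (b i)) = 0 := by
  set ν : ι → ℝ := fun i ↦ inner ℝ V (b i) / inner ℝ V V with hν
  have hb : ∀ i, b i = orthComp V (b i) + ν i • V := fun i ↦ (orthComp_add_smul V (b i)).symm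
  -- The coefficients of the basis vectors along V reassemble a multiple of V, which turns sums over
  -- the basis into evaluations of A at V.
  have hsum : ∑ i, ν i • b i = (inner ℝ V V)⁻¹ • V := by
    simp only [hν, div_eq_inv_mul, mul_smul, ← Finset.smul_sum, sum_inner_smul_self]
  have hterm : ∀ i j, inner ℝ (T (b i) (b j)) (A (b j) (b i)) =
      inner ℝ (T V (orthComp V (b j))) (A (b j) (ν i • b i))
        + inner ℝ (T (b i) V) (A (ν j • b j) (b i)) := by
    intro i j
    -- A takes values in V^⊥, so the part of T with both arguments in V^⊥ does not see it.
    have h0 : inner ℝ (T (orthComp V (b i)) (orthComp V (b j))) (A (b j) (b i)) = 0 :=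
      hT.inner_eq_zero _ _ _ (inner_orthComp hV _) (inner_orthComp hV _)
        (by rw [real_inner_comm, hA.inner_eq_zero])
    have h1 : T (b i) (b j) = T (orthComp V (b i)) (orthComp V (b j))
        + ν i • T V (orthComp V (b j)) + ν j • T (b i) V := by
      conv_lhs => rw [hb j, map_add, map_smul]
      congr 1
      conv_lhs => rw [hb i, map_add, map_smul]
      rfl
    rw [h1, inner_add_left, inner_add_left, h0]
    simp [inner_smul_left, inner_smul_right]
  simp only [hterm, Finset.sum_add_distrib]
  have h2 : ∑ i, ∑ j, inner ℝ (T (b i) V) (A (ν j • b j) (b i)) = 0 := by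
    refine Finset.sum_eq_zero fun i _ ↦ ?_
    rw [← inner_sum, ← sum_apply, ← map_sum, hsum, map_smul, hA.apply_eq_zero]
    simp
  rw [h2, add_zero, Finset.sum_comm]
  simp only [← inner_sum, ← map_sum, hsum]
  have hperp : ∀ y, inner ℝ (orthComp V (T V (orthComp V y))) V = 0 := fun y ↦ by
    rw [real_inner_comm, inner_orthComp hV]
  -- What remains pairs y ↦ T(V, y), compressed to V^⊥ and hence symmetric, with y ↦ A y V / |V|²,
  -- which is skew.
  have h3 := sum_inner_eq_zero_of_symm_skew b (S := fun y ↦ orthComp V (T V (orthComp V y)))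
    (K := fun y ↦ A y ((inner ℝ V V)⁻¹ • V)) ?_ fun x y ↦ hA.skew _ _ _
  · rw [← h3]
    refine Finset.sum_congr rfl fun j _ ↦ ?_
    rw [real_inner_comm, real_inner_comm _ (orthComp V _),
      inner_orthComp_right (hA.inner_eq_zero _ _)]
  · intro x y
    have hcomp : ∀ x y, inner ℝ (orthComp V (T V (orthComp V x))) y =
        inner ℝ (T V (orthComp V x)) (orthComp V y) := fun x y ↦ by
      rw [← inner_orthComp_right (hperp x), real_inner_comm,
        inner_orthComp_right (by rw [real_inner_comm, inner_orthComp hV]), real_inner_comm]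
    rw [hcomp, hcomp, hT.inner_symm _ _ (inner_orthComp hV _) (inner_orthComp hV _)]

/-- A difference tensor is determined by its alternation. -/
theorem IsDifferenceTensor.eq_zero (hA : IsDifferenceTensor V A) (h : ∀ x y, A y x = A x y) :
    A = 0 := by
  refine ContinuousLinearMap.ext fun y ↦ ContinuousLinearMap.ext fun x ↦
    ext_inner_right ℝ fun z ↦ ?_
  -- A trilinear form that is skew in one pair of arguments and symmetric in an overlapping pair
  -- vanishes; three cyclic instances suffice.
  have h1 := hA.skew x y z
  have h2 := hA.skew y z x
  have h3 := hA.skew z x y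
  rw [h x y] at h1
  rw [h y z] at h2
  rw [h z x] at h3
  have h4 : inner ℝ (A y x) z = inner ℝ (A x y) z := by rw [h x y]
  simp only [zero_apply, inner_zero_left]
  linarith

/-- Passes from orthogonality over all pairs of indices to the pairs i < j counted by the torsion
norm. -/
theorem sum_Ioi_eq_half [LinearOrder ι] [LocallyFiniteOrderTop ι] {g : ι → ι → ℝ}
    (h0 : ∀ i, g i i = 0) (hg : ∀ i j, g i j = g j i) :
    ∑ i, ∑ j, g i j = 2 * ∑ i, ∑ j ∈ Finset.Ioi i, g i j := by
  have h1 : ∀ i j, g i j = (if i < j then g i j else 0) + (if j < i then g j i else 0) := by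
    intro i j
    rcases lt_trichotomy i j with h | rfl | h
    · simp [h, h.not_gt]
    · simp [h0]
    · simp [h, h.not_gt, hg i j]
  have h2 : ∑ i, ∑ j ∈ Finset.Ioi i, g i j = ∑ i, ∑ j, if i < j then g i j else 0 := by
    refine Finset.sum_congr rfl fun i _ ↦ ?_
    rw [← Finset.sum_filter]
    refine Finset.sum_congr ?_ fun _ _ ↦ rfl
    ext j
    simp
  rw [h2, Finset.sum_congr rfl fun i _ ↦ Finset.sum_congr rfl fun j _ ↦ h1 i j]
  simp only [Finset.sum_add_distrib]
  rw [Finset.sum_comm (f := fun i j ↦ if j < i then g j i else 0)]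
  ring

/-- Pythagoras' theorem for the torsion norm. -/
theorem IsExtremalTensor.sum_norm_sq_add [LinearOrder ι] [LocallyFiniteOrderTop ι] (hV : V ≠ 0)
    (hT : IsExtremalTensor V T) (hanti : ∀ x y, T x y = -T y x) (hA : IsDifferenceTensor V A) :
    ∑ i, ∑ j ∈ Finset.Ioi i, ‖T (b i) (b j) + (A (b j) (b i) - A (b i) (b j))‖ ^ 2 =
      ∑ i, ∑ j ∈ Finset.Ioi i, ‖T (b i) (b j)‖ ^ 2 +
        ∑ i, ∑ j ∈ Finset.Ioi i, ‖A (b j) (b i) - A (b i) (b j)‖ ^ 2 := by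
  have h1 : ∑ i, ∑ j ∈ Finset.Ioi i,
      inner ℝ (T (b i) (b j)) (A (b j) (b i) - A (b i) (b j)) = 0 := by
    have h2 := sum_Ioi_eq_half
      (g := fun i j ↦ inner ℝ (T (b i) (b j)) (A (b j) (b i) - A (b i) (b j)))
      (fun i ↦ by simp) (fun i j ↦ by
        rw [hanti, inner_neg_left, ← inner_neg_right, neg_sub])
    have h3 := hT.sum_inner_eq_zero b hV hA
    have h4 : ∑ i, ∑ j, inner ℝ (T (b i) (b j)) (A (b i) (b j)) = 0 := by
      rw [Finset.sum_comm, ← neg_eq_zero, ← h3]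
      simp only [← Finset.sum_neg_distrib]
      refine Finset.sum_congr rfl fun j _ ↦ Finset.sum_congr rfl fun i _ ↦ ?_
      rw [hanti, inner_neg_left, neg_neg]
    simp only [inner_sub_right, Finset.sum_sub_distrib] at h2 h3 h4 ⊢
    linarith
  simp only [norm_add_sq_real, Finset.sum_add_distrib, ← Finset.mul_sum, h1]
  ring

/-- The form `(y, z) ↦ ⟪S y, z⟫ - ⟪S z, y⟫`, made to vanish on `V`. -/
def twist (V : W) (S : W →L[ℝ] W) (y z : W) : ℝ :=
  inner ℝ (S y) z - inner ℝ (S z) y - inner ℝ V y / inner ℝ V V * inner ℝ (S V) z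
    + inner ℝ V z / inner ℝ V V * inner ℝ (S V) y

/-- The difference tensor of the extremal compatible connection and the Levi-Civita connection as
a trilinear form, where `V` is the dual vector field and `S x` its covariant derivative. -/
def extremalForm (V : W) (S : W →L[ℝ] W) (y x z : W) : ℝ :=
  -- The first two terms, skew in y and z, cancel S when y = V. The last one removes the skew part
  -- of ⟨T(V, y), z⟩ on V^⊥; the correction terms in `twist` make it vanish for y = V when S maps
  -- into V^⊥, so V stays parallel.
  (inner ℝ V z * inner ℝ (S x) y - inner ℝ V y * inner ℝ (S x) z
    - inner ℝ V x / 2 * twist V S y z) / inner ℝ V V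

theorem extremalForm_skew (V : W) (S : W →L[ℝ] W) (y x z : W) :
    extremalForm V S y x z = -extremalForm V S z x y := by
  simp only [extremalForm, twist]
  ring

variable [FiniteDimensional ℝ W]

/-- The difference tensor of the extremal compatible connection and the Levi-Civita connection. -/
def extremalDifference (V : W) (S : W →L[ℝ] W) : W →L[ℝ] W →L[ℝ] W :=
  haveI := FiniteDimensional.complete ℝ W
  LinearMap.toContinuousLinearMap <| (LinearMap.toContinuousLinearMap (𝕜 := ℝ) (E := W)
    (F' := W)).toLinearMap ∘ₗ LinearMap.mk₂ ℝ
    (fun y x ↦ (inner ℝ V V)⁻¹ • (inner ℝ (S x) y • V - inner ℝ V y • S x - (inner ℝ V x / 2) •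
      (S y - S.adjoint y - (inner ℝ V y / inner ℝ V V) • S V
        + (inner ℝ (S V) y / inner ℝ V V) • V)))
    (fun y y' x ↦ by simp only [inner_add_right, map_add]; module)
    (fun a y x ↦ by simp only [real_inner_smul_right, map_smul]; module)
    (fun y x x' ↦ by simp only [inner_add_left, inner_add_right, map_add]; module)
    (fun a y x ↦ by simp only [real_inner_smul_left, real_inner_smul_right, map_smul]; module)

theorem inner_extremalDifference (V : W) (S : W →L[ℝ] W) (y x z : W) :
    inner ℝ (extremalDifference V S y x) z = extremalForm V S y x z := by
  have := FiniteDimensional.complete ℝ W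
  simp only [extremalDifference, LinearMap.coe_toContinuousLinearMap', LinearMap.comp_apply,
    LinearEquiv.coe_coe, LinearMap.mk₂_apply, inner_sub_left, inner_add_left,
    real_inner_smul_left, ContinuousLinearMap.adjoint_inner_left, extremalForm, twist,
    real_inner_comm (S z) y]
  ring

theorem extremalDifference_self (hV : V ≠ 0) {S : W →L[ℝ] W} (hS : ∀ x, inner ℝ (S x) V = 0)
    (x : W) : extremalDifference V S V x = -S x := by
  have := (real_inner_self_pos.2 hV).ne'
  refine ext_inner_right ℝ fun z ↦ ?_
  rw [inner_extremalDifference, inner_neg_left, extremalForm, twist, hS, hS, hS]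
  field_simp
  ring

/-- Every term of `extremalForm` has a factor ⟨V, ·⟩, so nothing survives on V^⊥; and for y, z in
V^⊥ the value ⟨T(V, y), z⟩ is the symmetrization (⟨S y, z⟩ + ⟨S z, y⟩)/2. -/
theorem isExtremalTensor_of_eq (hV : V ≠ 0) {S : W →L[ℝ] W} (hS : ∀ x, inner ℝ (S x) V = 0)
    (hT : ∀ x y, T x y = extremalDifference V S y x - extremalDifference V S x y) :
    IsExtremalTensor V T where
  inner_eq_zero x y z hx hy hz := by
    rw [hT, inner_sub_left, inner_extremalDifference, inner_extremalDifference]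
    simp [extremalForm, hx, hy, hz]
  inner_symm y z hy hz := by
    have := (real_inner_self_pos.2 hV).ne'
    simp only [hT, inner_sub_left, extremalDifference_self hV hS, inner_extremalDifference]
    simp only [extremalForm, twist, hy, hz, inner_neg_left]
    field_simp
    ring

end Algebra

/-! ### The extremal compatible connection -/

section Extremal

variable {n : ℕ} {M : Type*} [TopologicalSpace M] [ChartedSpace (EuclideanSpace ℝ (Fin n)) M]
  [IsManifold (𝓡 n) ∞ M]

theorem difference_apply (nabla nabla' : LinConn n M) {Y : ∀ x : M, TangentSpace (𝓡 n) x} {x : M}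
    (hY : DiffFieldAt Y x) :
    nabla'.difference nabla x (Y x) = nabla' Y x - nabla Y x :=
  IsCovariantDerivativeOn.difference_apply _ _ (mem_univ x) hY

theorem torsion_eq_add {nabla nabla' : LinConn n M} {x : M}
    {A : TangentSpace (𝓡 n) x →L[ℝ] TangentSpace (𝓡 n) x →L[ℝ] TangentSpace (𝓡 n) x}
    (h : ∀ Y : ∀ x : M, TangentSpace (𝓡 n) x, DiffFieldAt Y x → nabla' Y x = nabla Y x + A (Y x))
    (u v : TangentSpace (𝓡 n) x) :
    nabla'.torsion x u v = nabla.torsion x u v + (A v u - A u v) := by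
  rw [CovariantDerivative.torsion_apply_eq_extend, CovariantDerivative.torsion_apply_eq_extend,
    h _ (diffFieldAt_extend u), h _ (diffFieldAt_extend v)]
  simp only [add_apply, FiberBundle.extend_apply_self]
  abel

theorem torsion_eq_add_difference (nabla nabla' : LinConn n M) {x : M}
    (u v : TangentSpace (𝓡 n) x) :
    nabla'.torsion x u v = nabla.torsion x u v +
      (nabla'.difference nabla x v u - nabla'.difference nabla x u v) :=
  torsion_eq_add (fun Y hY ↦ by rw [difference_apply nabla nabla' hY]; abel) u v

variable [RiemannianBundle (fun x : M ↦ TangentSpace (𝓡 n) x)]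

theorem torsionNorm_eq (nabla : LinConn n M) (x : M) :
    torsionNorm nabla x = √(∑ i, ∑ j ∈ Finset.Ioi i,
      ‖nabla.torsion x (stdOrthonormalBasis ℝ (TangentSpace (𝓡 n) x) i)
        (stdOrthonormalBasis ℝ (TangentSpace (𝓡 n) x) j)‖ ^ 2) := by
  simp only [torsionNorm, OrthonormalBasis.sum_sq_inner_left]

variable [IsContMDiffRiemannianBundle (𝓡 n) ∞ (EuclideanSpace ℝ (Fin n))
    (fun x : M ↦ TangentSpace (𝓡 n) x)]
  {β : ∀ x : M, TangentSpace (𝓡 n) x →L[ℝ] ℝ} {F : TangentBundle (𝓡 n) M → ℝ}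
  {nabla nabla' : LinConn n M}

theorem mvfderiv_inner_of_metric (hm : nabla.IsMetricCompatible) {x : M}
    {Y Z : ∀ x : M, TangentSpace (𝓡 n) x}
    (hY : DiffFieldAt Y x) (hZ : DiffFieldAt Z x) (u : TangentSpace (𝓡 n) x) :
    mvfderiv (𝓡 n) (fun y ↦ inner ℝ (Y y) (Z y)) x u =
      inner ℝ (nabla Y x u) (Z x) + inner ℝ (Y x) (nabla Z x u) := by
  rw [mvfderiv_inner nabla hY hZ, congr_fun hm x]
  simp

/-- The two product rules for the same function ⟨v, w⟩ are subtracted. -/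
theorem difference_skew (hm : nabla.IsMetricCompatible) (hm' : nabla'.IsMetricCompatible) {x : M}
    (u v w : TangentSpace (𝓡 n) x) :
    inner ℝ (nabla'.difference nabla x v u) w = -inner ℝ (nabla'.difference nabla x w u) v := by
  have hv := diffFieldAt_extend v
  have hw := diffFieldAt_extend w
  have h1 := mvfderiv_inner_of_metric hm hv hw u
  have h2 := mvfderiv_inner_of_metric hm' hv hw u
  have h3 := difference_apply nabla nabla' hv
  have h4 := difference_apply nabla nabla' hw
  simp only [FiberBundle.extend_apply_self] at h1 h2 h3 h4
  rw [h3, h4, sub_apply, sub_apply, inner_sub_left, inner_sub_left,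
    real_inner_comm v (nabla' _ _ _), real_inner_comm v (nabla _ _ _)]
  linarith

theorem isDifferenceTensor [T2Space M] (hF : IsRandersMetric F β) (h : IsCompatible nabla F)
    (h' : IsCompatible nabla' F) (x : M) :
    IsDifferenceTensor (sharp β x) (nabla'.difference nabla x) where
  skew u v w := difference_skew (h.isMetricCompatible hF) (h'.isMetricCompatible hF) u v w
  apply_eq_zero := by
    rw [difference_apply nabla nabla' (diffFieldAt_sharp hF x), h.sharp_parallel hF,
      h'.sharp_parallel hF, sub_zero]

/-- The equality case of Pythagoras: the alternation of the difference tensor vanishes, and with it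
the tensor. -/
theorem difference_eq_zero_of_torsionNorm_le [T2Space M] (hF : IsRandersMetric F β)
    (h : IsCompatible nabla F) (h' : IsCompatible nabla' F) {x : M} (hV : sharp β x ≠ 0)
    (hT : IsExtremalTensor (sharp β x) (nabla.torsion x))
    (hle : torsionNorm nabla' x ≤ torsionNorm nabla x) : nabla'.difference nabla x = 0 := by
  have hA := isDifferenceTensor hF h h' x
  set b := stdOrthonormalBasis ℝ (TangentSpace (𝓡 n) x) with hb
  have hsum := hT.sum_norm_sq_add b hV (nabla.torsion_antisymm) hA
  simp only [← torsion_eq_add_difference] at hsum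
  rw [torsionNorm_eq, torsionNorm_eq, Real.sqrt_le_sqrt_iff (by positivity), ← hb, hsum] at hle
  have h0 : ∑ i, ∑ j ∈ Finset.Ioi i, ‖nabla'.difference nabla x (b j) (b i)
      - nabla'.difference nabla x (b i) (b j)‖ ^ 2 = 0 :=
    le_antisymm (by linarith) (by positivity)
  have h1 : ∀ i j, i < j → nabla'.difference nabla x (b j) (b i) =
      nabla'.difference nabla x (b i) (b j) := by
    intro i j hij
    have h2 := (Finset.sum_eq_zero_iff_of_nonneg (fun i _ ↦ by positivity)).1 h0 i
      (Finset.mem_univ i)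
    have h3 := (Finset.sum_eq_zero_iff_of_nonneg (fun j _ ↦ by positivity)).1 h2 j
      (Finset.mem_Ioi.2 hij)
    simpa [sub_eq_zero] using h3
  refine hA.eq_zero fun u v ↦ ?_
  have h2 : (nabla'.difference nabla x).toLinearMap₁₂ =
      (nabla'.difference nabla x).toLinearMap₁₂.flip := by
    refine LinearMap.ext_basis b.toBasis b.toBasis fun i j ↦ ?_
    rcases lt_trichotomy i j with hij | rfl | hij
    · simpa using (h1 i j hij).symm
    · simp
    · simpa using h1 j i hij
  exact congr($h2 v u)

theorem torsionNorm_le [T2Space M] (hF : IsRandersMetric F β)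
    (h : IsCompatible nabla F) (h' : IsCompatible nabla' F) {x : M} (hV : sharp β x ≠ 0)
    (hT : IsExtremalTensor (sharp β x) (nabla.torsion x)) :
    torsionNorm nabla x ≤ torsionNorm nabla' x := by
  have hsum := hT.sum_norm_sq_add (stdOrthonormalBasis ℝ (TangentSpace (𝓡 n) x)) hV
    (nabla.torsion_antisymm) (isDifferenceTensor hF h h' x)
  simp only [← torsion_eq_add_difference] at hsum
  rw [torsionNorm_eq, torsionNorm_eq, hsum]
  refine Real.sqrt_le_sqrt (le_add_of_nonneg_right (by positivity))

/-- The extremal compatible linear connection. -/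
def extremalConnection (β : ∀ x : M, TangentSpace (𝓡 n) x →L[ℝ] ℝ) : LinConn n M :=
  (leviCivita n M).addOneForm fun x ↦
    extremalDifference (sharp β x) (leviCivita n M (sharp β) x)

theorem extremalConnection_apply (β : ∀ x : M, TangentSpace (𝓡 n) x →L[ℝ] ℝ)
    (Y : ∀ x : M, TangentSpace (𝓡 n) x) (x : M) :
    extremalConnection β Y x = leviCivita n M Y x +
      extremalDifference (sharp β x) (leviCivita n M (sharp β) x) (Y x) :=
  rfl

/-- This is the derivative of the constant ⟨V, V⟩, and the place where constant length enters the
construction. -/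
theorem inner_leviCivita_sharp (hF : IsRandersMetric F β) {L : ℝ} (hL : ∀ x, ‖sharp β x‖ = L)
    (x : M) (u : TangentSpace (𝓡 n) x) :
    inner ℝ (leviCivita n M (sharp β) x u) (sharp β x) = 0 := by
  have h1 := mvfderiv_inner_of_metric (isLeviCivita_leviCivita (n := n) (M := M)).metric
    (diffFieldAt_sharp hF x) (diffFieldAt_sharp hF x) u
  simp only [real_inner_self_eq_norm_sq, hL, mvfderiv_const, zero_apply] at h1
  rw [real_inner_comm] at h1
  linarith [real_inner_comm (leviCivita n M (sharp β) x u) (sharp β x)]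

theorem isMetricCompatible_extremalConnection :
    (extremalConnection β).IsMetricCompatible := by
  rw [CovariantDerivative.isMetricCompatible_iff]
  intro x X Y Z hX hY hZ
  rw [mvfderiv_inner_of_metric isLeviCivita_leviCivita.metric hY hZ]
  simp only [extremalConnection_apply, add_apply, inner_add_left, inner_add_right]
  rw [inner_extremalDifference, extremalForm_skew, ← inner_extremalDifference,
    real_inner_comm (Y x)]
  ring

theorem extremalConnection_sharp (hF : IsRandersMetric F β) {L : ℝ} (hL : ∀ x, ‖sharp β x‖ = L)
    (hV : ∀ x, sharp β x ≠ 0) (x : M) : extremalConnection β (sharp β) x = 0 := by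
  refine ContinuousLinearMap.ext fun u ↦ ?_
  rw [extremalConnection_apply, add_apply,
    extremalDifference_self (hV x) (inner_leviCivita_sharp hF hL x)]
  simp

theorem isExtremalTensor_extremalConnection (hF : IsRandersMetric F β) {L : ℝ}
    (hL : ∀ x, ‖sharp β x‖ = L) (hV : ∀ x, sharp β x ≠ 0) (x : M) :
    IsExtremalTensor (sharp β x) ((extremalConnection β).torsion x) := by
  refine isExtremalTensor_of_eq (hV x) (inner_leviCivita_sharp hF hL x) fun u v ↦ ?_
  rw [torsion_eq_add (fun Y _ ↦ extremalConnection_apply β Y x),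
    (isLeviCivita_leviCivita (n := n) (M := M)).torsion_free]
  simp

theorem smooth_extremalConnection [T2Space M] (hF : IsRandersMetric F β) {L : ℝ}
    (hL : ∀ x, ‖sharp β x‖ = L) :
    (extremalConnection β).ContMDiffCovariantDerivative ∞ where
  contMDiff :=
    { contMDiff := fun {Y} hY x _ ↦ by
        have hY' : ∀ y, SmoothFieldAt Y y := fun y ↦
          (hY.contMDiffAt Filter.univ_mem).of_le (by simp)
        have hV := smoothFieldAt_sharp hF x
        have hS : SmoothHomAt (leviCivita n M (sharp β)) x :=
          contMDiffAt_covariantDerivative smooth_leviCivita Filter.univ_mem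
            fun y _ ↦ smoothFieldAt_sharp hF y
        have hSX : ∀ {X : ∀ x : M, TangentSpace (𝓡 n) x}, SmoothFieldAt X x →
            SmoothFieldAt (fun y ↦ leviCivita n M (sharp β) y (X y)) x := fun hX ↦
          ContMDiffAt.clm_bundle_apply hS hX
        have hDY : SmoothHomAt (leviCivita n M Y) x :=
          contMDiffAt_covariantDerivative smooth_leviCivita Filter.univ_mem fun y _ ↦ hY' y
        refine ContMDiffAt.contMDiffWithinAt (contMDiffAt_hom_of_frame fun i ↦
          contMDiffAt_of_inner_frame fun j ↦ ?_)
        have hX := contMDiffAt_frame (mem_frameDomain (n := n) x) i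
        have hZ := contMDiffAt_frame (mem_frameDomain (n := n) x) j
        have hDYX : SmoothFieldAt (fun y ↦ leviCivita n M Y y (frame x i y)) x :=
          ContMDiffAt.clm_bundle_apply hDY hX
        -- Constant length turns every denominator ⟨V, V⟩ into a constant, leaving sums and products
        -- of smooth functions.
        simp only [extremalConnection_apply, add_apply, inner_add_left, inner_extremalDifference,
          extremalForm, twist, real_inner_self_eq_norm_sq, hL, div_eq_mul_inv]
        have hY := hY' x
        refine (hDYX.inner hZ).add (ContMDiffAt.mul ?_ contMDiffAt_const)
        refine (((hV.inner hZ).mul ((hSX hX).inner hY)).sub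
          ((hV.inner hY).mul ((hSX hX).inner hZ))).sub
          (((hV.inner hX).mul contMDiffAt_const).mul ?_)
        exact ((((hSX hY).inner hZ).sub ((hSX hZ).inner hY)).sub
          (((hV.inner hY).mul contMDiffAt_const).mul ((hSX hV).inner hZ))).add
          (((hV.inner hZ).mul contMDiffAt_const).mul ((hSX hV).inner hY)) }

theorem isCompatible_extremalConnection [T2Space M] (hF : IsRandersMetric F β) {L : ℝ}
    (hL : ∀ x, ‖sharp β x‖ = L) (hV : ∀ x, sharp β x ≠ 0) :
    IsCompatible (extremalConnection β) F :=
  isCompatible_of_metric hF (smooth_extremalConnection hF hL)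
    isMetricCompatible_extremalConnection (extremalConnection_sharp hF hL hV)

theorem isExtremal_extremalConnection [T2Space M] (hF : IsRandersMetric F β) {L : ℝ}
    (hL : ∀ x, ‖sharp β x‖ = L) (hV : ∀ x, sharp β x ≠ 0) :
    IsExtremal (extremalConnection β) F where
  compatible := isCompatible_extremalConnection hF hL hV
  minimal _ h p := torsionNorm_le hF (isCompatible_extremalConnection hF hL hV) h (hV p)
    (isExtremalTensor_extremalConnection hF hL hV p)

theorem IsExtremal.difference_eq_zero [T2Space M] (hF : IsRandersMetric F β) {L : ℝ}
    (hL : ∀ x, ‖sharp β x‖ = L) (hV : ∀ x, sharp β x ≠ 0) (h : IsExtremal nabla F) (x : M) :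
    nabla.difference (extremalConnection β) x = 0 :=
  have hc := isCompatible_extremalConnection hF hL hV
  difference_eq_zero_of_torsionNorm_le hF hc h.compatible (hV x)
    (isExtremalTensor_extremalConnection hF hL hV x) (h.minimal _ hc x)

/-- The difference tensor controls the connections only on differentiable fields, hence the
hypothesis on Y. -/
theorem IsExtremal.apply_eq [T2Space M] (hF : IsRandersMetric F β) {L : ℝ}
    (hL : ∀ x, ‖sharp β x‖ = L) (hV : ∀ x, sharp β x ≠ 0) (h : IsExtremal nabla F) {x : M}
    {Y : ∀ x : M, TangentSpace (𝓡 n) x} (hY : DiffFieldAt Y x) :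
    nabla Y x = extremalConnection β Y x := by
  rw [← sub_eq_zero, ← difference_apply _ _ hY, h.difference_eq_zero hF hL hV]
  rfl

theorem IsExtremal.isExtremalTensor [T2Space M] (hF : IsRandersMetric F β) {L : ℝ}
    (hL : ∀ x, ‖sharp β x‖ = L) (hV : ∀ x, sharp β x ≠ 0) (h : IsExtremal nabla F) (x : M) :
    IsExtremalTensor (sharp β x) (nabla.torsion x) := by
  have h1 : nabla.torsion x = (extremalConnection β).torsion x := by
    refine ContinuousLinearMap.ext fun u ↦ ContinuousLinearMap.ext fun v ↦ ?_
    rw [torsion_eq_add_difference (extremalConnection β) nabla, h.difference_eq_zero hF hL hV]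
    simp
  rw [h1]
  exact isExtremalTensor_extremalConnection hF hL hV x

end Extremal

/-! ### Adapted coordinates -/

section Components

variable {n : ℕ} {M : Type*} [TopologicalSpace M] [ChartedSpace (EuclideanSpace ℝ (Fin n)) M]
  {e : OpenPartialHomeomorph M (EuclideanSpace ℝ (Fin n))} {p : M}

theorem coord_eq_inner [RiemannianBundle (fun x : M ↦ TangentSpace (𝓡 n) x)]
    (he : e ∈ IsManifold.maximalAtlas (𝓡 n) ∞ M) (hp : p ∈ e.source)
    (ho : Orthonormal ℝ (fun i ↦ coordField e i p)) (w : TangentSpace (𝓡 n) p) (k : Fin n) :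
    coord e w k = inner ℝ w (coordField e k p) := by
  conv_rhs => rw [← sum_coord_smul he hp w, sum_inner]
  simp only [real_inner_smul_left, orthonormal_iff_ite.1 ho]
  simp

variable [IsManifold (𝓡 n) ∞ M]

theorem torsionComp_eq (nabla : LinConn n M) (he : e ∈ IsManifold.maximalAtlas (𝓡 n) ∞ M)
    (hp : p ∈ e.source) (i j k : Fin n) :
    torsionComp e nabla i j k p = connParam e nabla i j k p - connParam e nabla j i k p := by
  have h := nabla.torsion_apply (diffFieldAt_coordField he hp i) (diffFieldAt_coordField he hp j)
  rw [torsionComp, h, mlieBracket_coordField he hp, sub_zero]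
  exact map_sub (coordL e p k) _ _

theorem connParam_symm {D : LinConn n M} (hD : D.torsion = 0)
    (he : e ∈ IsManifold.maximalAtlas (𝓡 n) ∞ M)
    (hp : p ∈ e.source) (i j k : Fin n) : connParam e D i j k p = connParam e D j i k p := by
  have h := torsionComp_eq D he hp i j k
  have h0 : torsionComp e D i j k p = 0 := by
    rw [torsionComp, hD]
    exact map_zero (coordL e p k)
  linarith

variable [RiemannianBundle (fun x : M ↦ TangentSpace (𝓡 n) x)]
  [IsContMDiffRiemannianBundle (𝓡 n) ∞ (EuclideanSpace ℝ (Fin n))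
    (fun x : M ↦ TangentSpace (𝓡 n) x)]
  {β : ∀ x : M, TangentSpace (𝓡 n) x →L[ℝ] ℝ} {F : TangentBundle (𝓡 n) M → ℝ}
  {nabla D : LinConn n M}

/-- Orthonormality holds at p only, so neither set of parameters need be skew by itself; in the
difference the derivatives of the metric coefficients cancel. -/
theorem connParam_sub_skew (hm : nabla.IsMetricCompatible) (hD : D.IsMetricCompatible)
    (he : e ∈ IsManifold.maximalAtlas (𝓡 n) ∞ M) (hp : p ∈ e.source)
    (ho : Orthonormal ℝ (fun i ↦ coordField e i p)) (i j k : Fin n) :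
    connParam e nabla i j k p - connParam e D i j k p =
      -(connParam e nabla i k j p - connParam e D i k j p) := by
  have h := difference_skew hD hm (coordField e i p) (coordField e j p) (coordField e k p)
  rw [difference_apply D nabla (diffFieldAt_coordField he hp j),
    difference_apply D nabla (diffFieldAt_coordField he hp k), sub_apply, sub_apply,
    inner_sub_left, inner_sub_left] at h
  simpa only [connParam, coord_eq_inner he hp ho] using h

/-- Here β_j = ⟨V, ∂_j⟩ with V parallel, so only the derivative of ∂_j contributes. -/
theorem partialDeriv_formComp (hF : IsRandersMetric F β) (hm : nabla.IsMetricCompatible)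
    (hV : nabla (sharp β) p = 0) (he : e ∈ IsManifold.maximalAtlas (𝓡 n) ∞ M)
    (hp : p ∈ e.source) (i j : Fin n) :
    partialDeriv e i (formComp e β j) p =
      inner ℝ (sharp β p) (nabla (coordField e j) p (coordField e i p)) := by
  have hj := diffFieldAt_coordField he hp j
  have hs := diffFieldAt_sharp hF p
  have h1 : formComp e β j = fun x ↦ inner ℝ (sharp β x) (coordField e j x) := by
    funext x
    rw [inner_sharp, formComp]
  rw [h1, partialDeriv_eq he hp i (hs.inner hj), mvfderiv_inner_of_metric hm hs hj, hV]
  simp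

end Components

section Adapted

variable {m : ℕ} {M : Type*} [TopologicalSpace M]
  [ChartedSpace (EuclideanSpace ℝ (Fin (m + 1))) M] [IsManifold (𝓡 (m + 1)) ∞ M]
  [RiemannianBundle (fun x : M ↦ TangentSpace (𝓡 (m + 1)) x)]
  {F : TangentBundle (𝓡 (m + 1)) M → ℝ} {β : ∀ x : M, TangentSpace (𝓡 (m + 1)) x →L[ℝ] ℝ}
  {nabla D : LinConn (m + 1) M} {e : OpenPartialHomeomorph M (EuclideanSpace ℝ (Fin (m + 1)))}
  {p : M}

theorem IsAdapted.sharp_eq (h : IsAdapted e β p) :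
    sharp β p = formComp e β (Fin.last m) p • coordField e (Fin.last m) p := by
  have hcoord : ∀ k, coord e (sharp β p) k = formComp e β k p := fun k ↦ by
    rw [coord_eq_inner h.mem_atlas h.mem_source h.orthonormal, inner_sharp, formComp]
  conv_lhs => rw [← sum_coord_smul h.mem_atlas h.mem_source (sharp β p), Fin.sum_univ_castSucc]
  simp [hcoord, h.formComp_eq_zero]

theorem IsAdapted.inner_sharp_castSucc (h : IsAdapted e β p) (a : Fin m) :
    inner ℝ (sharp β p) (coordField e a.castSucc p) = 0 := by
  rw [inner_sharp]
  exact h.formComp_eq_zero a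

theorem IsAdapted.torsionComp_castSucc (h : IsAdapted e β p)
    (hT : IsExtremalTensor (sharp β p) (nabla.torsion p)) (a b c : Fin m) :
    torsionComp e nabla a.castSucc b.castSucc c.castSucc p = 0 := by
  rw [torsionComp, coord_eq_inner h.mem_atlas h.mem_source h.orthonormal]
  exact hT.inner_eq_zero _ _ _ (h.inner_sharp_castSucc a) (h.inner_sharp_castSucc b)
    (h.inner_sharp_castSucc c)

theorem IsAdapted.torsionComp_last_symm (h : IsAdapted e β p)
    (hT : IsExtremalTensor (sharp β p) (nabla.torsion p)) (a c : Fin m) :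
    torsionComp e nabla a.castSucc (Fin.last m) c.castSucc p =
      torsionComp e nabla c.castSucc (Fin.last m) a.castSucc p := by
  have h1 := hT.inner_symm _ _ (h.inner_sharp_castSucc a) (h.inner_sharp_castSucc c)
  rw [h.sharp_eq] at h1
  simp only [map_smul, smul_apply, real_inner_smul_left, mul_eq_mul_left_iff,
    h.formComp_last_ne_zero, or_false] at h1
  rw [nabla.torsion_antisymm, nabla.torsion_antisymm (coordField e (Fin.last m) p),
    inner_neg_left, inner_neg_left, neg_inj] at h1
  simpa only [torsionComp, coord_eq_inner h.mem_atlas h.mem_source h.orthonormal] using h1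

variable [T2Space M]
  [IsContMDiffRiemannianBundle (𝓡 (m + 1)) ∞ (EuclideanSpace ℝ (Fin (m + 1)))
    (fun x : M ↦ TangentSpace (𝓡 (m + 1)) x)]

/-- In adapted coordinates, the derivatives of the form give connection parameters of any
compatible connection. -/
theorem IsAdapted.partialDeriv_formComp_eq (h : IsAdapted e β p) (hF : IsRandersMetric F β)
    (hc : IsCompatible nabla F) (i j : Fin (m + 1)) :
    partialDeriv e i (formComp e β j) p =
      formComp e β (Fin.last m) p * connParam e nabla i j (Fin.last m) p := by
  rw [partialDeriv_formComp hF (hc.isMetricCompatible hF) (hc.sharp_parallel hF p) h.mem_atlas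
    h.mem_source, h.sharp_eq, real_inner_smul_left, real_inner_comm, connParam,
    coord_eq_inner h.mem_atlas h.mem_source h.orthonormal]

/-- The case a = c is included and yields the rear diagonal elements. -/
theorem IsAdapted.torsionComp_rear (h : IsAdapted e β p) (hF : IsRandersMetric F β)
    (hc : IsCompatible nabla F) (hT : IsExtremalTensor (sharp β p) (nabla.torsion p))
    (hD : IsLeviCivita D) (a c : Fin m) :
    torsionComp e nabla a.castSucc (Fin.last m) c.castSucc p =
      connParam e D a.castSucc c.castSucc (Fin.last m) p -
        1 / (2 * formComp e β (Fin.last m) p) *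
          (partialDeriv e a.castSucc (formComp e β c.castSucc) p +
            partialDeriv e c.castSucc (formComp e β a.castSucc) p) := by
  have hn := h.formComp_last_ne_zero
  have skew := connParam_sub_skew (hc.isMetricCompatible hF) hD.metric h.mem_atlas h.mem_source
    h.orthonormal
  have symm := connParam_symm hD.torsion_free h.mem_atlas h.mem_source
  have h1 := h.torsionComp_last_symm hT a c
  rw [h.partialDeriv_formComp_eq hF hc, h.partialDeriv_formComp_eq hF hc, ← mul_add]
  have h2 : ∀ t : ℝ, 1 / (2 * formComp e β (Fin.last m) p) * (formComp e β (Fin.last m) p * t) =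
      t / 2 := fun t ↦ by field_simp
  rw [h2]
  rw [torsionComp_eq nabla h.mem_atlas h.mem_source,
    torsionComp_eq nabla h.mem_atlas h.mem_source] at h1
  rw [torsionComp_eq nabla h.mem_atlas h.mem_source]
  -- By symmetry T_an^c is half of T_an^c + T_cn^a. In this sum skewness replaces Γ_na^c + Γ_nc^a by
  -- its Levi-Civita counterpart and trades Γ_an^c, Γ_cn^a for Γ_ac^n, Γ_ca^n.
  linarith [skew a.castSucc c.castSucc (Fin.last m), skew c.castSucc a.castSucc (Fin.last m),
    skew (Fin.last m) a.castSucc c.castSucc, symm a.castSucc c.castSucc (Fin.last m),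
    symm a.castSucc (Fin.last m) c.castSucc, symm c.castSucc (Fin.last m) a.castSucc]

end Adapted

end RandersGB

end

/-- The dimension is `m + 1`: the indices `1, …, n - 1` of the text are `a.castSucc` with
`a : Fin m`, and the index `n` is `Fin.last m`. -/
theorem theorem1 {m : ℕ} {M : Type*} [TopologicalSpace M] [T2Space M] [ConnectedSpace M]
    [ChartedSpace (EuclideanSpace ℝ (Fin (m + 1))) M] [IsManifold (𝓡 (m + 1)) ∞ M]
    [RiemannianBundle (fun x : M ↦ TangentSpace (𝓡 (m + 1)) x)]
    [IsContMDiffRiemannianBundle (𝓡 (m + 1)) ∞ (EuclideanSpace ℝ (Fin (m + 1)))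
      (fun x : M ↦ TangentSpace (𝓡 (m + 1)) x)]
    (F : TangentBundle (𝓡 (m + 1)) M → ℝ)
    (β : ∀ x : M, TangentSpace (𝓡 (m + 1)) x →L[ℝ] ℝ)
    (hF : IsRandersMetric F β)
    (hnR : ¬ IsRiemannianNorm F) :
    -- existence of a compatible linear connection
    ((∃ nabla : LinConn (m + 1) M, IsCompatible nabla F) ↔
      ∃ L : ℝ, 0 < L ∧ ∀ x : M, ‖sharp β x‖ = L) ∧
    -- in that case the extremal compatible linear connection exists and is unique
    ((∃ nabla : LinConn (m + 1) M, IsCompatible nabla F) →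
      ∃ nabla : LinConn (m + 1) M, IsExtremal nabla F) ∧
    (∀ nabla nabla' : LinConn (m + 1) M,
      IsExtremal nabla F → IsExtremal nabla' F →
      ∀ (x : M) (Y : ∀ x : M, TangentSpace (𝓡 (m + 1)) x),
        MDifferentiableAt (𝓡 (m + 1)) (𝓡 (m + 1)).tangent
          (fun y ↦ (⟨y, Y y⟩ : TangentBundle (𝓡 (m + 1)) M)) x →
        nabla Y x = nabla' Y x) ∧
    -- its connection parameters and torsion components in adapted coordinates
    ∀ nabla D : LinConn (m + 1) M,
      IsExtremal nabla F → IsLeviCivita D →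
      ∀ (p : M) (e : OpenPartialHomeomorph M (EuclideanSpace ℝ (Fin (m + 1)))),
        IsAdapted e β p →
        (∀ i j r, connParam e nabla i j r p = connParam e D i j r p -
          1 / 2 * (torsionComp e nabla j r i p + torsionComp e nabla i r j p -
            torsionComp e nabla i j r p)) ∧
        -- front short blocks
        (∀ a b c : Fin m, a < b →
          torsionComp e nabla a.castSucc b.castSucc c.castSucc p = 0) ∧
        -- front tails
        (∀ a b : Fin m, a < b → torsionComp e nabla a.castSucc b.castSucc (Fin.last m) p =
          1 / formComp e β (Fin.last m) p *
            (partialDeriv e a.castSucc (formComp e β b.castSucc) p -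
              partialDeriv e b.castSucc (formComp e β a.castSucc) p)) ∧
        -- rear diagonal elements
        (∀ a : Fin m, torsionComp e nabla a.castSucc (Fin.last m) a.castSucc p =
          connParam e D a.castSucc a.castSucc (Fin.last m) p -
            1 / formComp e β (Fin.last m) p *
              partialDeriv e a.castSucc (formComp e β a.castSucc) p) ∧
        -- rear tails
        (∀ a : Fin m, torsionComp e nabla a.castSucc (Fin.last m) (Fin.last m) p =
          connParam e D a.castSucc (Fin.last m) (Fin.last m) p -
            1 / formComp e β (Fin.last m) p *
              partialDeriv e (Fin.last m) (formComp e β a.castSucc) p) ∧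
        -- non-diagonal elements of the rear short blocks
        (∀ a c : Fin m, a ≠ c → torsionComp e nabla a.castSucc (Fin.last m) c.castSucc p =
          connParam e D a.castSucc c.castSucc (Fin.last m) p -
            1 / (2 * formComp e β (Fin.last m) p) *
              (partialDeriv e a.castSucc (formComp e β c.castSucc) p +
                partialDeriv e c.castSucc (formComp e β a.castSucc) p)) := by
  have hne : ∀ {L : ℝ}, 0 < L → (∀ x : M, ‖sharp β x‖ = L) → ∀ x : M, sharp β x ≠ 0 :=
    fun hL0 hL x ↦ norm_pos_iff.1 ((hL x).symm ▸ hL0)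
  have hlen : (∃ nabla : LinConn (m + 1) M, IsCompatible nabla F) →
      ∃ L : ℝ, 0 < L ∧ ∀ x : M, ‖sharp β x‖ = L := by
    rintro ⟨nabla, h⟩
    obtain ⟨x, hx⟩ : ∃ x, sharp β x ≠ 0 := by
      by_contra! h0
      exact hnR (isRiemannianNorm_of_sharp_eq_zero hF h0)
    exact ⟨‖sharp β x‖, norm_pos_iff.2 hx, fun y ↦ h.norm_sharp_eq hF y x⟩
  refine ⟨⟨hlen, fun ⟨L, hL0, hL⟩ ↦ ⟨_, isCompatible_extremalConnection hF hL (hne hL0 hL)⟩⟩,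
    fun h ↦ ?_, fun nabla nabla' h h' x Y hY ↦ ?_, fun nabla D h hD p e he ↦ ?_⟩
  · obtain ⟨L, hL0, hL⟩ := hlen h
    exact ⟨_, isExtremal_extremalConnection hF hL (hne hL0 hL)⟩
  · obtain ⟨L, hL0, hL⟩ := hlen ⟨nabla, h.compatible⟩
    rw [h.apply_eq hF hL (hne hL0 hL) hY, h'.apply_eq hF hL (hne hL0 hL) hY]
  obtain ⟨L, hL0, hL⟩ := hlen ⟨nabla, h.compatible⟩
  have hT := h.isExtremalTensor hF hL (hne hL0 hL) p
  have hn := he.formComp_last_ne_zero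
  have skew := connParam_sub_skew (h.compatible.isMetricCompatible hF) hD.metric he.mem_atlas
    he.mem_source he.orthonormal
  have symm := connParam_symm hD.torsion_free he.mem_atlas he.mem_source
  have tors := torsionComp_eq nabla he.mem_atlas he.mem_source
  have part := he.partialDeriv_formComp_eq hF h.compatible
  refine ⟨fun i j r ↦ ?_, fun a b c _ ↦ he.torsionComp_castSucc hT a b c, fun a b _ ↦ ?_,
    fun a ↦ ?_, fun a ↦ ?_, fun a c _ ↦ he.torsionComp_rear hF h.compatible hT hD a c⟩
  · rw [tors, tors, tors]
    -- The usual contorsion computation: Γ − Γ* is skew in its last two indices and its alternation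
    -- in the first two is T, so a cyclic combination solves for it.
    linarith [skew i j r, skew j i r, skew r i j, symm i j r, symm i r j, symm j r i]
  · rw [tors, part, part]
    field_simp
  · rw [he.torsionComp_rear hF h.compatible hT hD a a, part]
    field_simp
    ring
  · rw [tors, part]
    field_simp
    -- Skewness with both last indices equal to n gives Γ_an^n = Γ*_an^n.
    linarith [skew a.castSucc (Fin.last m) (Fin.last m)]
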